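/- Let $U\subset\mathbb{C}$ be an open neighbourhood of $0$, and let $f,g:U\to\mathbb{C}$ be invertible (i.e. injective) holomorphic functions with $f(0)=g(0)=0$. Let $J\subset U$ be a subset that is closed in $U$ and completely invariant under both $f$ and $g$ near $0$: for $h=f$ and for $h=g$ there is a neighbourhood $V_h\subset U$ of $0$ with $h(J)\cap V_h=J\cap V_h$ and $h^{-1}(J)\cap V_h=J\cap V_h$. Suppose that the tangent cone of $J$ at $0$ (the set of all limits $\lim_k c_k z_k$ with $z_k\in J$, $z_k\to 0$ and $c_k\ge 0$) is not equal to $\mathbb{C}$. Then at least one of the following holds: 1. there is an open neighbourhood $V\subset U$ of $0$ such that $J$ is analytically laminated in $V\setminus\{0\}$, that is, every $z\in V\setminus\{0\}$ has an open neighbourhood $W$ with $J\cap W=\sigma^{-1}(K)$ for some set $K\subset\mathbb{R}$ and some real-analytic function $\sigma:W\to\mathbb{R}$ whose differential is nonzero at every point of $W$; 2. there is $(m,n)\in\mathbb{Z}^2\setminus\{(0,0)\}$ such that $f^m=g^n$ in a neighbourhood of $0$, where $f^m$ denotes the $m$-th iterate of $f$ (for $m<0$, the $|m|$-th iterate of the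 inverse of $f$), and similarly for $g^n$. -/

import Mathlib

open Set Filter Topology

/-- The local iterate `f ^ m`, `m ∈ ℤ`, of an invertible map `f` : the `m`-fold composition of `f`
when `m ≥ 0`, and the `|m|`-fold composition of the inverse map when `m < 0`. It is only used for
maps fixing `0`, as a germ at `0`. -/
noncomputable def localIterate (f : OpenPartialHomeomorph ℂ ℂ) : ℤ → ℂ → ℂ
  | Int.ofNat n => f^[n]
  | Int.negSucc n => f.symm^[n + 1]

/-- A subset `J` of `U` is completely invariant near `0` under the map `f`, defined on `U`, if for
some neighbourhood `V ⊆ U` of `0` one has `f(J) ∩ V = J ∩ V` and `f⁻¹(J) ∩ V = J ∩ V`. -/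
def CompletelyInvariantNearZero (f : ℂ → ℂ) (U J : Set ℂ) : Prop :=
  ∃ V ∈ 𝓝 (0 : ℂ), V ⊆ U ∧ (f '' J) ∩ V = J ∩ V ∧ (U ∩ f ⁻¹' J) ∩ V = J ∩ V

/-- `J` is analytically laminated at `z` : on an open neighbourhood `V` of `z`, the set `J` is
`σ⁻¹(K)` for some `K ⊆ ℝ` and some real analytic `σ : V → ℝ` of maximal rank at every point. -/
def AnalyticallyLaminatedAt (J : Set ℂ) (z : ℂ) : Prop :=
  ∃ V : Set ℂ, IsOpen V ∧ z ∈ V ∧ ∃ (σ : ℂ → ℝ) (K : Set ℝ),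
    AnalyticOnNhd ℝ σ V ∧ (∀ w ∈ V, Function.Surjective (fderiv ℝ σ w)) ∧
    J ∩ V = V ∩ σ ⁻¹' K

/-- `J` is analytically laminated in `W` : it is so at every point of `W`. -/
def AnalyticallyLaminatedIn (J W : Set ℂ) : Prop :=
  ∀ z ∈ W, AnalyticallyLaminatedAt J z

/-! If `J` does not accumulate at 0, lamination is trivial (`K = ∅`). Otherwise the missing tangent
direction gives a sector free of `J`, and some power of each multiplier is positive, since a
rotation of infinite order would carry `J` into the sector (`exists_pow_multiplier_eq_norm`).
Passing to iterates, both multipliers may be taken positive.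

Lamination comes from renormalisation (`exists_radius_laminated_of_orbit`). Let `f` be a germ z + a
z^(k+1) + ⋯, where k = 0 is the case of a multiplier 1 + a ≠ 1. Follow an orbit z_n → 0 of `f`
through the windows z_n + z_n^(k+1) ζ. If ∑ |z_n|^(k+1) < ∞, the maps between successive windows
compose to an injective limit chart. Another invariant germ y + b y^(l+1) + ⋯ with l ≥ k becomes, in
the window, a step of about ε κ(ζ) with ε = b z_n^(l-k). If l > k, or if a family of such germs has
b → 0, the steps become infinitesimal. Iterating them forwards and backwards shows that `J`, read in
the chart, is invariant under the local flow of κ, so it is a union of level curves. Every point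
near 0 has a summable orbit under `f` or its inverse.

It remains to find such germs, or a relation (`laminated_or_relation`). If a multiplier is not 1,
the words g^n f^m have multipliers exp (m α + n β). When β / α is irrational these come arbitrarily
close to 1 without reaching it. When it is rational, some word is tangent to the identity: it is the
identity, which is a relation, or it has higher order. If both germs are tangent to the identity and
have the same order, the same argument applies to their leading coefficients when the ratio is real.
When the ratio is not real, a minimisation in the coordinate log z shows that `J` cannot accumulate
at 0 (`eventually_notMem_of_independent`). For different orders, the germ of higher order is the one
needed. -/

open Asymptotics

/-! ### Small steps along a vector field and lamination. -/

/-- Iterating a step which, read in the coordinate `S`, is almost the translation by `ε`. -/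
theorem exists_iterate_near_translation {S : ℂ → ℂ} {r : ℝ}
    (hS : ∀ x ∈ Metric.ball (0 : ℂ) r, ∀ y ∈ Metric.ball (0 : ℂ) r,
      ‖S x - S y - (x - y)‖ ≤ 1 / 2 * ‖x - y‖) (hS0 : S 0 = 0) {A : Set ℂ} {ε : ℂ} {η : ℝ}
    (hstep : ∀ x ∈ A, ‖x‖ < r / 2 → ∃ y ∈ A, ‖y‖ < r ∧ ‖S y - S x - ε‖ ≤ η * ‖ε‖)
    {x : ℂ} (hx : x ∈ A) (N : ℕ) (hN : ‖S x‖ + N * ((1 + η) * ‖ε‖) < r / 4) (hη : 0 ≤ η)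
    (hxr : ‖x‖ < r / 2) :
    ∃ y ∈ A, ‖y‖ < r / 2 ∧ ‖S y - S x - N * ε‖ ≤ N * (η * ‖ε‖) := by
  have hr : 0 < r := by linarith [norm_nonneg x]
  induction N with
  | zero => exact ⟨x, hx, hxr, by simp⟩
  | succ N ih =>
    have hpos : 0 ≤ (1 + η) * ‖ε‖ := by positivity
    push_cast at hN ⊢
    obtain ⟨y, hyA, hyr, hy⟩ := ih (by nlinarith)
    obtain ⟨w, hwA, hwr, hw⟩ := hstep y hyA hyr
    have h1 : ‖S w - S x - (N + 1) * ε‖ ≤ (N + 1) * (η * ‖ε‖) := by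
      have : S w - S x - (N + 1) * ε = (S w - S y - ε) + (S y - S x - N * ε) := by ring
      rw [this]
      refine (norm_add_le _ _).trans ?_
      linarith
    refine ⟨w, hwA, ?_, h1⟩
    have h2 : ‖S w‖ < r / 4 := by
      have : S w = (S w - S x - (N + 1) * ε) + S x + (N + 1) * ε := by ring
      have h3 : ‖((N : ℂ) + 1) * ε‖ = (N + 1) * ‖ε‖ := by
        rw [norm_mul]; congr 1
        exact_mod_cast Complex.norm_natCast (N + 1)
      calc ‖S w‖ = ‖(S w - S x - (N + 1) * ε) + S x + (N + 1) * ε‖ := by rw [← this]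
        _ ≤ ‖S w - S x - (N + 1) * ε‖ + ‖S x‖ + ‖((N : ℂ) + 1) * ε‖ := norm_add₃_le
        _ ≤ (N + 1) * (η * ‖ε‖) + ‖S x‖ + (N + 1) * ‖ε‖ := by rw [h3]; linarith
        _ < r / 4 := by linarith
    -- Since `‖S w - w‖ ≤ ‖w‖ / 2`, one has `‖w‖ ≤ 2 * ‖S w‖`: the bound `r / 4` in the coordinate
    -- gives back the bound `r / 2` that the next step requires.
    have h3 := hS w (by simpa using hwr) 0 (by simpa using hr)
    rw [hS0, sub_zero, sub_zero] at h3
    have h4 : ‖w‖ ≤ ‖S w‖ + ‖S w - w‖ := by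
      have := norm_sub_le (S w) (S w - w)
      simpa using this
    linarith

/-- The quantitative open mapping theorem on a disc, without the assumption that the function is
not locally constant. -/
theorem ball_subset_image_closedBall_of_le {f : ℂ → ℂ} {p : ℂ} {ρ m : ℝ}
    (h : DiffContOnCl ℂ f (Metric.ball p ρ)) (hρ : 0 < ρ) (hm : 0 < m)
    (hle : ∀ x ∈ Metric.sphere p ρ, m ≤ ‖f x - f p‖) :
    Metric.ball (f p) (m / 2) ⊆ f '' Metric.closedBall p ρ := by
  refine h.ball_subset_image_closedBall hρ hle ?_
  by_contra hcon
  rw [not_frequently] at hcon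
  simp only [not_not] at hcon
  have hev : EqOn f (fun _ => f p) (Metric.ball p ρ) :=
    (h.differentiableOn.analyticOnNhd Metric.isOpen_ball).eqOn_of_preconnected_of_eventuallyEq
      analyticOnNhd_const (convex_ball p ρ).isPreconnected (Metric.mem_ball_self hρ) hcon
  obtain ⟨x, hx⟩ : (Metric.sphere p ρ).Nonempty := NormedSpace.sphere_nonempty.2 hρ.le
  have hcl : EqOn f (fun _ => f p) (closure (Metric.ball p ρ)) :=
    hev.of_subset_closure h.continuousOn continuousOn_const subset_closure subset_rfl
  have := hle x hx
  rw [hcl (by rw [closure_ball p hρ.ne']; exact Metric.sphere_subset_closedBall hx)] at this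
  simp at this
  linarith

/-- A holomorphic function uniformly close to an injective one covers a fixed ball. -/
theorem exists_ball_subset_image_of_uniform {ι : Type*} {l : Filter ι} {ψ : ι → ℂ → ℂ}
    {Ψ : ℂ → ℂ} {B : Set ℂ}
    (hψ : ∀ᶠ n in l, DifferentiableOn ℂ (ψ n) B)
    (hlim : ∀ η > 0, ∀ᶠ n in l, ∀ w ∈ B, ‖ψ n w - Ψ w‖ < η)
    (hinj : InjOn Ψ B) (hcont : ContinuousOn Ψ B) {p : ℂ} {ρ : ℝ} (hρ : 0 < ρ)
    (hp : Metric.closedBall p ρ ⊆ B) :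
    ∃ m > 0, ∀ᶠ n in l, Metric.ball (Ψ p) m ⊆ ψ n '' Metric.closedBall p ρ := by
  have hsph : Metric.sphere p ρ ⊆ B := Metric.sphere_subset_closedBall.trans hp
  have hpB : p ∈ B := hp (Metric.mem_closedBall_self hρ.le)
  obtain ⟨m, hm, hmle⟩ : ∃ m > 0, ∀ x ∈ Metric.sphere p ρ, m ≤ ‖Ψ x - Ψ p‖ := by
    have hne : (Metric.sphere p ρ).Nonempty := NormedSpace.sphere_nonempty.2 hρ.le
    obtain ⟨x, hx, hmin⟩ := (isCompact_sphere p ρ).exists_isMinOn hne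
      (f := fun x => ‖Ψ x - Ψ p‖) ((hcont.mono hsph).sub continuousOn_const).norm
    refine ⟨‖Ψ x - Ψ p‖, ?_, fun y hy => hmin hy⟩
    rw [gt_iff_lt, norm_pos_iff, sub_ne_zero]
    intro h
    have := hinj (hsph hx) hpB h
    rw [this, mem_sphere_iff_norm, sub_self, norm_zero] at hx
    exact hρ.ne hx
  -- Errors of `m / 8` at two points leave at least `m / 2` on the circle, so the ball of radius `m
  -- / 4` about `ψ n p` is covered. It contains the ball of radius `m / 8` about `Ψ p`.
  refine ⟨m / 8, by positivity, ?_⟩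
  filter_upwards [hψ, hlim (m / 8) (by positivity)] with n hd hn
  have h1 : DiffContOnCl ℂ (ψ n) (Metric.ball p ρ) :=
    (hd.mono ((closure_ball p hρ.ne').subset.trans hp)).diffContOnCl
  have hnp := hn p hpB
  have h2 : ∀ x ∈ Metric.sphere p ρ, m / 2 ≤ ‖ψ n x - ψ n p‖ := by
    intro x hx
    have h3 := hmle x hx
    have h4 := hn x (hsph hx)
    have h5 : Ψ x - Ψ p = (ψ n x - ψ n p) - (ψ n x - Ψ x) + (ψ n p - Ψ p) := by ring
    have h6 := norm_add_le ((ψ n x - ψ n p) - (ψ n x - Ψ x)) (ψ n p - Ψ p)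
    have h7 := norm_sub_le (ψ n x - ψ n p) (ψ n x - Ψ x)
    rw [← h5] at h6
    linarith
  refine Subset.trans ?_ (ball_subset_image_closedBall_of_le h1 hρ (by positivity) h2)
  intro y hy
  rw [Metric.mem_ball, dist_eq_norm] at hy ⊢
  have : y - ψ n p = (y - Ψ p) - (ψ n p - Ψ p) := by ring
  rw [this]
  refine (norm_sub_le _ _).trans_lt ?_
  linarith

/-- The flow of a limit of almost-translations preserves a closed invariant set. -/
theorem mem_of_limit_of_steps {ι : Type*} {l : Filter ι} [l.NeBot] {ψ : ι → ℂ → ℂ}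
    {Ψ : ℂ → ℂ} {B : Set ℂ} (hB : IsOpen B)
    (hψ : ∀ᶠ n in l, DifferentiableOn ℂ (ψ n) B)
    (hlim : ∀ η > 0, ∀ᶠ n in l, ∀ w ∈ B, ‖ψ n w - Ψ w‖ < η)
    (hinj : InjOn Ψ B) (hcont : ContinuousOn Ψ B)
    {J : Set ℂ} (hJ : IsClosed J) {A : ι → Set ℂ}
    (hA : ∀ᶠ n in l, ∀ w ∈ B, ψ n w ∈ A n ↔ w ∈ J)
    {S : ℂ → ℂ} {r : ℝ}
    (hS : ∀ x ∈ Metric.ball (0 : ℂ) r, ∀ y ∈ Metric.ball (0 : ℂ) r,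
      ‖S x - S y - (x - y)‖ ≤ 1 / 2 * ‖x - y‖) (hS0 : S 0 = 0)
    {ε : ι → ℂ} (hε0 : ∀ᶠ n in l, ε n ≠ 0) (hε : Tendsto ε l (𝓝 0)) {e : ℂ}
    (he : Tendsto (fun n => ε n / ‖ε n‖) l (𝓝 e))
    (hstep : ∀ η > 0, ∀ᶠ n in l, ∀ x ∈ A n, ‖x‖ < r / 2 →
      ∃ y ∈ A n, ‖y‖ < r ∧ ‖S y - S x - ε n‖ ≤ η * ‖ε n‖)
    {z p : ℂ} (hz : z ∈ B) (hzJ : z ∈ J) (hp : p ∈ B) {t : ℝ} (ht : 0 ≤ t)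
    (hpz : S (Ψ p) - S (Ψ z) = t * e) (hΨz : ‖Ψ z‖ < r / 2) (hΨp : ‖Ψ p‖ < r)
    (hsmall : ‖S (Ψ z)‖ + t < r / 4) : p ∈ J := by
  have hr : 0 < r := by linarith [norm_nonneg (Ψ z)]
  -- If `p ∉ J`, a disc around `p` misses `J`, hence `A n` misses a fixed ball around `Ψ p`. But
  -- about `t / ‖ε n‖` steps starting from `ψ n z` lead to a point of `A n` inside that ball.
  by_contra hpJ
  obtain ⟨ρ, hρ, hρB⟩ := Metric.nhds_basis_closedBall.mem_iff.1
    ((hB.inter hJ.isOpen_compl).mem_nhds ⟨hp, hpJ⟩)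
  obtain ⟨m, hm, hcov⟩ := exists_ball_subset_image_of_uniform hψ hlim hinj hcont hρ
    (hρB.trans inter_subset_left)
  have hdisj : ∀ᶠ n in l, ∀ x ∈ A n, m ≤ ‖x - Ψ p‖ := by
    filter_upwards [hcov, hA] with n hn hAn x hx
    by_contra! hlt
    obtain ⟨w, hw, rfl⟩ := hn (by rwa [Metric.mem_ball, dist_eq_norm] : x ∈ Metric.ball (Ψ p) m)
    exact (hρB hw).2 ((hAn w (hρB hw).1).1 hx)
  have hlimz : Tendsto (fun n => ψ n z) l (𝓝 (Ψ z)) := by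
    rw [Metric.tendsto_nhds]
    intro η hη
    filter_upwards [hlim η hη] with n hn
    rw [dist_eq_norm]; exact hn z hz
  have hScont : ContinuousOn S (Metric.ball 0 r) := by
    have : LipschitzOnWith 2 S (Metric.ball 0 r) := by
      refine LipschitzOnWith.of_dist_le_mul fun x hx y hy => ?_
      rw [dist_eq_norm, dist_eq_norm]
      have h1 := hS x hx y hy
      have h2 := norm_add_le (S x - S y - (x - y)) (x - y)
      rw [sub_add_cancel] at h2
      have : ((2 : NNReal) : ℝ) = 2 := rfl
      rw [this]
      linarith [norm_nonneg (x - y)]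
    exact this.continuousOn
  have hSlim : Tendsto (fun n => S (ψ n z)) l (𝓝 (S (Ψ z))) :=
    ((hScont.continuousAt (Metric.isOpen_ball.mem_nhds
      (by simp; linarith : Ψ z ∈ Metric.ball (0 : ℂ) r))).tendsto).comp hlimz
  set N : ι → ℕ := fun n => ⌊t / ‖ε n‖⌋₊ with hN
  have hNε : Tendsto (fun n => (N n : ℝ) * ‖ε n‖) l (𝓝 t) := by
    have hn0 : Tendsto (fun n => ‖ε n‖) l (𝓝 0) := by simpa using hε.norm
    have hlow : Tendsto (fun n => t - ‖ε n‖) l (𝓝 t) := by simpa using tendsto_const_nhds.sub hn0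
    refine tendsto_of_tendsto_of_tendsto_of_le_of_le' hlow tendsto_const_nhds ?_ ?_
    · filter_upwards [hε0] with n hn
      have h1 := Nat.lt_floor_add_one (t / ‖ε n‖)
      have h2 : 0 < ‖ε n‖ := norm_pos_iff.2 hn
      rw [div_lt_iff₀ h2] at h1
      simp only [hN]; linarith
    · filter_upwards [hε0] with n hn
      have h2 : 0 < ‖ε n‖ := norm_pos_iff.2 hn
      have h1 := Nat.floor_le (div_nonneg ht h2.le)
      rwa [le_div_iff₀ h2] at h1
  have hNe : Tendsto (fun n => (N n : ℂ) * ε n) l (𝓝 (t * e)) := by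
    have h1 : Tendsto (fun n => (((N n : ℝ) * ‖ε n‖ : ℝ) : ℂ) * (ε n / ‖ε n‖)) l (𝓝 (t * e)) :=
      ((Complex.continuous_ofReal.tendsto t).comp hNε).mul he
    refine h1.congr' ?_
    filter_upwards [hε0] with n hn
    have : (‖ε n‖ : ℂ) ≠ 0 := by simpa using hn
    push_cast
    field_simp
  obtain ⟨η, hη, hη1, hη2⟩ : ∃ η > 0, η * (t + 1) < m / 8 ∧
      ‖S (Ψ z)‖ + t + η * (t + 1) < r / 4 := by
    obtain ⟨q, hq, hq'⟩ : ∃ q > 0, q < m / 8 ∧ q < r / 4 - (‖S (Ψ z)‖ + t) :=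
      ⟨min (m / 8) (r / 4 - (‖S (Ψ z)‖ + t)) / 2, by
        have : 0 < min (m / 8) (r / 4 - (‖S (Ψ z)‖ + t)) := lt_min (by positivity) (by linarith)
        positivity, by
        have h0 : 0 < min (m / 8) (r / 4 - (‖S (Ψ z)‖ + t)) := lt_min (by positivity) (by linarith)
        constructor
        · linarith [min_le_left (m / 8) (r / 4 - (‖S (Ψ z)‖ + t))]
        · linarith [min_le_right (m / 8) (r / 4 - (‖S (Ψ z)‖ + t))]⟩
    refine ⟨q / (t + 1), by positivity, ?_⟩
    rw [div_mul_cancel₀ _ (by positivity : t + 1 ≠ 0)]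
    exact ⟨hq'.1, by linarith⟩
  have hev : ∀ᶠ n in l, ‖S (ψ n z)‖ + N n * ((1 + η) * ‖ε n‖) < r / 4 := by
    have h1 : Tendsto (fun n => ‖S (ψ n z)‖ + N n * ((1 + η) * ‖ε n‖)) l
        (𝓝 (‖S (Ψ z)‖ + (1 + η) * t)) := by
      refine (hSlim.norm.add (hNε.const_mul (1 + η))).congr fun n => ?_
      ring
    exact h1.eventually (gt_mem_nhds (by nlinarith))
  have hev2 : ∀ᶠ n in l, ‖S (ψ n z) + N n * ε n - S (Ψ p)‖ < m / 8 := by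
    have h1 : Tendsto (fun n => S (ψ n z) + N n * ε n - S (Ψ p)) l (𝓝 0) := by
      have := (hSlim.add hNe).sub (tendsto_const_nhds (x := S (Ψ p)))
      rwa [← hpz, add_sub_cancel, sub_self] at this
    have := h1.norm
    rw [norm_zero] at this
    exact this.eventually (gt_mem_nhds (by positivity))
  have hev3 : ∀ᶠ n in l, (N n : ℝ) * ‖ε n‖ < t + 1 := hNε.eventually (gt_mem_nhds (by linarith))
  obtain ⟨n, h1, h2, h3, h4, h5, h6, h7⟩ := (hdisj.and (hev.and (hev2.and (hev3.and
    ((hstep η hη).and (hA.and (hlimz.norm.eventually (gt_mem_nhds hΨz)))))))).exists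
  obtain ⟨y, hyA, hyr, hy⟩ := exists_iterate_near_translation hS hS0 h5 ((h6 z hz).2 hzJ)
    (N n) h2 hη.le h7
  have h8 := h1 y hyA
  have h9 := hS y (by simp; linarith) (Ψ p) (by simpa using hΨp)
  have h10 : ‖S y - S (Ψ p)‖ < m / 4 := by
    have : S y - S (Ψ p) = (S y - S (ψ n z) - N n * ε n) + (S (ψ n z) + N n * ε n - S (Ψ p)) := by
      ring
    rw [this]
    refine (norm_add_le _ _).trans_lt ?_
    have : (N n : ℝ) * (η * ‖ε n‖) ≤ η * (t + 1) := by nlinarith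
    linarith
  have h11 := norm_sub_le (S y - S (Ψ p)) (S y - S (Ψ p) - (y - Ψ p))
  rw [sub_sub_cancel] at h11
  linarith

/-- A coordinate in which the vector field `κ`, with `κ 0 = 1`, becomes the constant one. -/
theorem exists_straightening {κ : ℂ → ℂ} {r : ℝ} (hr : 0 < r)
    (hκ : DifferentiableOn ℂ κ (Metric.ball 0 r)) (hκ0 : κ 0 = 1) :
    ∃ S : ℂ → ℂ, ∃ s > 0, s ≤ r ∧ S 0 = 0 ∧
      (∀ x ∈ Metric.ball (0 : ℂ) s, ∃ d : ℂ, d ≠ 0 ∧ HasDerivAt S d x) ∧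
      (∀ x ∈ Metric.ball (0 : ℂ) s, ∀ y ∈ Metric.ball (0 : ℂ) s,
        ‖S x - S y - (x - y)‖ ≤ 1 / 2 * ‖x - y‖) ∧
      ∀ η > 0, ∃ δ > 0, ∀ ε x y : ℂ, ‖x‖ < s / 2 → ‖ε‖ < δ → ‖y - x - ε * κ x‖ ≤ δ * ‖ε‖ →
        ‖y‖ < s ∧ ‖S y - S x - ε‖ ≤ η * ‖ε‖ := by
  have hcont0 : ContinuousAt κ 0 := (hκ.continuousOn).continuousAt (Metric.ball_mem_nhds 0 hr)
  have hci : ContinuousAt (fun x => (κ x)⁻¹) 0 := hcont0.inv₀ (by simp [hκ0])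
  have hev : ∀ᶠ x in 𝓝 (0 : ℂ), κ x ≠ 0 ∧ ‖(κ x)⁻¹ - 1‖ < 1 / 2 ∧ x ∈ Metric.ball (0 : ℂ) r := by
    have h1 : ∀ᶠ x in 𝓝 (0 : ℂ), κ x ≠ 0 := hcont0.eventually_ne (by simp [hκ0])
    have h2 := Metric.tendsto_nhds.1 hci (1 / 2) (by norm_num)
    simp only [hκ0, inv_one, dist_eq_norm] at h2
    exact h1.and (h2.and (Metric.ball_mem_nhds 0 hr))
  obtain ⟨t, ht, htB⟩ := Metric.nhds_basis_ball.mem_iff.1 hev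
  have hdi : DifferentiableOn ℂ (fun x => (κ x)⁻¹) (Metric.ball 0 t) := fun x hx =>
    ((hκ x (htB hx).2.2).mono (fun y hy => (htB hy).2.2)).inv (htB hx).1
  -- A primitive of `1 / κ` measures time along the flow of `κ`.
  obtain ⟨S₀, hS₀⟩ := hdi.isExactOn_ball
  set S : ℂ → ℂ := fun x => S₀ x - S₀ 0 with hSdef
  have hS : ∀ x ∈ Metric.ball (0 : ℂ) t, HasDerivAt S (κ x)⁻¹ x := fun x hx =>
    (hS₀ x hx).sub_const _
  have hbi : ∀ x ∈ Metric.ball (0 : ℂ) t, ∀ y ∈ Metric.ball (0 : ℂ) t,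
      ‖S x - S y - (x - y)‖ ≤ 1 / 2 * ‖x - y‖ := by
    intro x hx y hy
    have := (convex_ball (0 : ℂ) t).norm_image_sub_le_of_norm_hasDerivWithin_le
      (f := fun x => S x - x) (f' := fun x => (κ x)⁻¹ - 1) (C := 1 / 2)
      (fun w hw => ((hS w hw).sub (hasDerivAt_id w)).hasDerivWithinAt)
      (fun w hw => (htB hw).2.1.le) hy hx
    rwa [show S x - S y - (x - y) = (S x - x) - (S y - y) by ring]
  have htr : t / 2 ≤ r := by
    by_contra! hlt
    have h1 : (((t / 2 + r) / 2 : ℝ) : ℂ) ∈ Metric.ball (0 : ℂ) t := by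
      rw [mem_ball_zero_iff, Complex.norm_real, Real.norm_of_nonneg (by positivity)]; linarith
    have h2 := (htB h1).2.2
    rw [mem_ball_zero_iff, Complex.norm_real, Real.norm_of_nonneg (by positivity)] at h2
    linarith
  have hsub : Metric.closedBall (0 : ℂ) (t / 2) ⊆ Metric.ball 0 t :=
    Metric.closedBall_subset_ball (by linarith)
  have hsub' : Metric.ball (0 : ℂ) (t / 2) ⊆ Metric.ball 0 t := Metric.ball_subset_ball (by linarith)
  have huc : UniformContinuousOn (fun x => (κ x)⁻¹) (Metric.closedBall (0 : ℂ) (t / 2)) :=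
    (isCompact_closedBall 0 (t / 2)).uniformContinuousOn_of_continuous (hdi.continuousOn.mono hsub)
  refine ⟨S, t / 2, by positivity, htr, by simp [hSdef],
    fun x hx => ⟨_, inv_ne_zero (htB (hsub' hx)).1, hS x (hsub' hx)⟩,
    fun x hx y hy => hbi x (hsub' hx) y (hsub' hy), ?_⟩
  intro η hη
  obtain ⟨δ₁, hδ₁, hδ₁'⟩ := Metric.uniformContinuousOn_iff.1 huc (η / 8) (by positivity)
  refine ⟨min (min (δ₁ / 4) (t / 16)) (min (η / 8) 1), by positivity, ?_⟩
  intro ε x y hx hε hy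
  simp only [lt_min_iff] at hε
  have hxB : x ∈ Metric.ball (0 : ℂ) (t / 2) := by rw [mem_ball_zero_iff]; linarith
  have hxt := htB (hsub' hxB)
  have hκx : ‖κ x‖ ≤ 2 := by
    have h1 : 1 = ‖(κ x)⁻¹‖ * ‖κ x‖ := by rw [← norm_mul, inv_mul_cancel₀ hxt.1, norm_one]
    have h2 : 1 / 2 ≤ ‖(κ x)⁻¹‖ := by
      have := norm_sub_norm_le (1 : ℂ) (1 - (κ x)⁻¹)
      rw [sub_sub_cancel, norm_one, norm_sub_rev] at this
      linarith [hxt.2.1]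
    nlinarith [norm_nonneg (κ x)]
  have hy1 : ‖y - x - ε * κ x‖ ≤ 1 * ‖ε‖ := hy.trans (by gcongr; simp)
  have hy2 : ‖y - x - ε * κ x‖ ≤ η / 8 * ‖ε‖ := hy.trans (by gcongr; simp)
  have hyx : ‖y - x‖ ≤ 3 * ‖ε‖ := by
    have h1 := norm_add_le (y - x - ε * κ x) (ε * κ x)
    rw [sub_add_cancel, norm_mul] at h1
    nlinarith [norm_nonneg ε]
  have hyB : ‖y‖ < t / 2 := by
    have h1 := norm_add_le (y - x) x
    rw [sub_add_cancel] at h1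
    linarith
  refine ⟨hyB, ?_⟩
  set D := Metric.ball (0 : ℂ) (t / 2) ∩ Metric.ball x δ₁ with hD
  have hconv : Convex ℝ D := (convex_ball _ _).inter (convex_ball _ _)
  have hder : ‖(S y - (κ x)⁻¹ * y) - (S x - (κ x)⁻¹ * x)‖ ≤ η / 8 * ‖y - x‖ := by
    refine hconv.norm_image_sub_le_of_norm_hasDerivWithin_le
      (f := fun w => S w - (κ x)⁻¹ * w) (f' := fun w => (κ w)⁻¹ - (κ x)⁻¹) ?_ ?_
      ⟨hxB, Metric.mem_ball_self hδ₁⟩ ⟨by simpa using hyB, ?_⟩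
    · intro w hw
      have := ((hS w (hsub' hw.1)).sub ((hasDerivAt_id w).const_mul (κ x)⁻¹))
      simp only [mul_one] at this
      exact this.hasDerivWithinAt
    · intro w hw
      have := hδ₁' w (Metric.ball_subset_closedBall hw.1) x (Metric.ball_subset_closedBall hxB) hw.2
      rw [dist_eq_norm] at this
      exact this.le
    · rw [Metric.mem_ball, dist_eq_norm]; linarith
  have heq : S y - S x - ε = ((S y - (κ x)⁻¹ * y) - (S x - (κ x)⁻¹ * x))
      + (κ x)⁻¹ * (y - x - ε * κ x) := by
    have := inv_mul_cancel₀ hxt.1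
    linear_combination ε * this
  have hinv : ‖(κ x)⁻¹‖ ≤ 3 / 2 := by
    have := norm_add_le ((κ x)⁻¹ - 1) 1
    rw [sub_add_cancel, norm_one] at this
    linarith [hxt.2.1]
  rw [heq]
  refine (norm_add_le _ _).trans ?_
  rw [norm_mul]
  have h1 : ‖(κ x)⁻¹‖ * ‖y - x - ε * κ x‖ ≤ 3 / 2 * (η / 8 * ‖ε‖) := by gcongr
  have h2 : η / 8 * ‖y - x‖ ≤ η / 8 * (3 * ‖ε‖) := by gcongr
  nlinarith [norm_nonneg ε]

/-- A closed set admitting, in suitable charts at `z₀`, arbitrarily small steps forwards and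
backwards along a vector field is analytically laminated at `z₀`. -/
theorem analyticallyLaminatedAt_of_steps {ψ : ℕ → ℂ → ℂ} {Ψ : ℂ → ℂ} {z₀ : ℂ} {r₀ : ℝ}
    (hr₀ : 0 < r₀) (hψ : ∀ᶠ n in atTop, DifferentiableOn ℂ (ψ n) (Metric.ball z₀ r₀))
    (hlim : ∀ η > 0, ∀ᶠ n in atTop, ∀ w ∈ Metric.ball z₀ r₀, ‖ψ n w - Ψ w‖ < η)
    {c : ℝ} (hc : 0 < c)
    (hlow : ∀ w ∈ Metric.ball z₀ r₀, ∀ w' ∈ Metric.ball z₀ r₀, c * ‖w - w'‖ ≤ ‖Ψ w - Ψ w'‖)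
    (hΨ0 : Ψ z₀ = 0) {J : Set ℂ} (hJ : IsClosed J) {A : ℕ → Set ℂ}
    (hA : ∀ᶠ n in atTop, ∀ w ∈ Metric.ball z₀ r₀, ψ n w ∈ A n ↔ w ∈ J)
    {κ : ℂ → ℂ} {r : ℝ} (hr : 0 < r) (hκ : DifferentiableOn ℂ κ (Metric.ball 0 r))
    (hκ0 : κ 0 = 1) {ε : ℕ → ℂ} (hε0 : ∀ᶠ n in atTop, ε n ≠ 0) (hε : Tendsto ε atTop (𝓝 0))
    (hfwd : ∀ η > 0, ∀ᶠ n in atTop, ∀ x ∈ A n, ‖x‖ < r →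
      ∃ y ∈ A n, ‖y - x - ε n * κ x‖ ≤ η * ‖ε n‖)
    (hbwd : ∀ η > 0, ∀ᶠ n in atTop, ∀ x ∈ A n, ‖x‖ < r →
      ∃ y ∈ A n, ‖y - x + ε n * κ x‖ ≤ η * ‖ε n‖) :
    AnalyticallyLaminatedAt J z₀ := by
  obtain ⟨S, s, hs, hsr, hS0, hSd, hS, hconv⟩ := exists_straightening hr hκ hκ0
  -- The ultrafilter plays the role of a subsequence along which the directions `ε n / ‖ε n‖`
  -- converge.
  set l : Filter ℕ := ((hyperfilter ℕ : Ultrafilter ℕ) : Filter ℕ) with hl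
  have hle : l ≤ atTop := Nat.hyperfilter_le_atTop
  have hunif : TendstoUniformlyOn ψ Ψ atTop (Metric.ball z₀ r₀) := by
    rw [Metric.tendstoUniformlyOn_iff]
    intro η hη
    filter_upwards [hlim η hη] with n hn w hw
    rw [dist_comm, dist_eq_norm]; exact hn w hw
  have hΨd : DifferentiableOn ℂ Ψ (Metric.ball z₀ r₀) :=
    hunif.tendstoLocallyUniformlyOn.differentiableOn hψ Metric.isOpen_ball
  have hinj : InjOn Ψ (Metric.ball z₀ r₀) := by
    intro w hw w' hw' h
    have := hlow w hw w' hw'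
    rw [h, sub_self, norm_zero] at this
    have h0 : ‖w - w'‖ ≤ 0 := by
      by_contra! h1
      nlinarith
    exact sub_eq_zero.1 (norm_le_zero_iff.1 h0)
  have hΨder : ∀ w ∈ Metric.ball z₀ r₀, deriv Ψ w ≠ 0 := by
    intro w hw h0
    have hd := (hΨd.differentiableAt (Metric.isOpen_ball.mem_nhds hw)).hasDerivAt
    rw [h0, hasDerivAt_iff_tendsto_slope] at hd
    have h1 := hd.norm
    rw [norm_zero] at h1
    have h2 : ∀ᶠ y in 𝓝[≠] w, c ≤ ‖slope Ψ w y‖ := by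
      filter_upwards [self_mem_nhdsWithin, nhdsWithin_le_nhds (Metric.isOpen_ball.mem_nhds hw)]
        with y hy hyB
      have h3 := hlow y hyB w hw
      have h4 : 0 < ‖y - w‖ := norm_pos_iff.2 (sub_ne_zero.2 hy)
      rw [slope_def_field, norm_div, le_div_iff₀ h4]
      exact h3
    exact absurd (ge_of_tendsto h1 h2) (not_le.2 hc)
  obtain ⟨e, he1, he⟩ : ∃ e : ℂ, ‖e‖ = 1 ∧ Tendsto (fun n => ε n / ‖ε n‖) l (𝓝 e) := by
    have hmem : ((hyperfilter ℕ).map (fun n => ε n / ‖ε n‖) : Filter ℂ) ≤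
        𝓟 (Metric.sphere (0 : ℂ) 1) := by
      rw [le_principal_iff]
      have h1 : ∀ᶠ n in l, ε n ≠ 0 := hε0.filter_mono hle
      change (fun n => ε n / (‖ε n‖ : ℂ)) ⁻¹' Metric.sphere (0 : ℂ) 1 ∈ l
      filter_upwards [h1] with n hn
      have : ‖ε n‖ ≠ 0 := by simpa using hn
      simp [this]
    obtain ⟨e, he, hle⟩ := (isCompact_sphere (0 : ℂ) 1).ultrafilter_le_nhds _ hmem
    exact ⟨e, by simpa using he, hle⟩
  have hstep : ∀ (a : ℂ), ‖a‖ = 1 → (∀ η > 0, ∀ᶠ n in atTop, ∀ x ∈ A n, ‖x‖ < r →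
      ∃ y ∈ A n, ‖y - x - (a * ε n) * κ x‖ ≤ η * ‖ε n‖) →
      ∀ η > 0, ∀ᶠ n in l, ∀ x ∈ A n, ‖x‖ < s / 2 →
      ∃ y ∈ A n, ‖y‖ < s ∧ ‖S y - S x - a * ε n‖ ≤ η * ‖a * ε n‖ := by
    intro a ha h η hη
    obtain ⟨δ, hδ, hδ'⟩ := hconv η hη
    have h1 : ∀ᶠ n in atTop, ‖ε n‖ < δ := by
      have := hε.norm
      rw [norm_zero] at this
      exact this.eventually (gt_mem_nhds hδ)
    filter_upwards [hle (h δ hδ), hle h1] with n hn hn1 x hx hxs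
    obtain ⟨y, hy, hyx⟩ := hn x hx (by linarith)
    refine ⟨y, hy, hδ' (a * ε n) x y hxs ?_ ?_⟩
    · rwa [norm_mul, ha, one_mul]
    · rwa [norm_mul, ha, one_mul]
  have hΨc : ContinuousAt Ψ z₀ :=
    hΨd.continuousOn.continuousAt (Metric.ball_mem_nhds z₀ hr₀)
  have hSc : ContinuousAt S 0 := by
    obtain ⟨d, -, hd⟩ := hSd 0 (Metric.mem_ball_self hs)
    exact hd.continuousAt
  have hΘc : Tendsto (fun w => S (Ψ w)) (𝓝 z₀) (𝓝 0) := by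
    have h1 : ContinuousAt (fun w => S (Ψ w)) z₀ :=
      ContinuousAt.comp (g := S) (by rw [hΨ0]; exact hSc) hΨc
    simpa [ContinuousAt, hΨ0, hS0] using h1
  obtain ⟨ρ, hρ, hρV⟩ : ∃ ρ > 0, ∀ w ∈ Metric.ball z₀ ρ, w ∈ Metric.ball z₀ r₀ ∧ ‖Ψ w‖ < s / 2 ∧
      ‖S (Ψ w)‖ < s / 16 := by
    have h1 : ∀ᶠ w in 𝓝 z₀, w ∈ Metric.ball z₀ r₀ ∧ ‖Ψ w‖ < s / 2 ∧ ‖S (Ψ w)‖ < s / 16 := by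
      have h0 : ∀ᶠ w in 𝓝 z₀, w ∈ Metric.ball z₀ r₀ := Metric.ball_mem_nhds z₀ hr₀
      refine h0.and (Eventually.and ?_ ?_)
      · have : Tendsto (fun w => ‖Ψ w‖) (𝓝 z₀) (𝓝 0) := by simpa [hΨ0] using hΨc.tendsto.norm
        exact this.eventually (gt_mem_nhds (by positivity))
      · have : Tendsto (fun w => ‖S (Ψ w)‖) (𝓝 z₀) (𝓝 0) := by simpa using hΘc.norm
        exact this.eventually (gt_mem_nhds (by positivity))
    exact Metric.eventually_nhds_iff_ball.1 h1
  have he0 : e ≠ 0 := by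
    rintro rfl
    simp at he1
  have hΘd : ∀ w ∈ Metric.ball z₀ ρ, ∃ d : ℂ, d ≠ 0 ∧ HasDerivAt (fun w => S (Ψ w) / e) d w := by
    intro w hw
    obtain ⟨hw1, hw2, -⟩ := hρV w hw
    obtain ⟨d, hd0, hd⟩ := hSd (Ψ w) (by simp; linarith)
    have hd2 := (hΨd.differentiableAt (Metric.isOpen_ball.mem_nhds hw1)).hasDerivAt
    exact ⟨d * deriv Ψ w / e, div_ne_zero (mul_ne_zero hd0 (hΨder w hw1)) he0,
      (hd.comp w hd2).div_const e⟩
  -- With equal imaginary parts, the two points differ by a real time `t` along the direction `e`.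
  -- The sign of `t` decides between forward and backward steps.
  have key : ∀ z ∈ Metric.ball z₀ ρ, ∀ p ∈ Metric.ball z₀ ρ, z ∈ J →
      (S (Ψ z) / e).im = (S (Ψ p) / e).im → p ∈ J := by
    intro z hz p hp hzJ him
    obtain ⟨hz1, hz2, hz3⟩ := hρV z hz
    obtain ⟨hp1, hp2, hp3⟩ := hρV p hp
    set t : ℝ := ((S (Ψ p) - S (Ψ z)) / e).re with ht
    have hte : S (Ψ p) - S (Ψ z) = t * e := by
      have h1 : (S (Ψ p) - S (Ψ z)) / e = t := by
        apply Complex.ext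
        · simp [ht]
        · rw [sub_div, Complex.sub_im, him]; simp
      rw [← h1, div_mul_cancel₀ _ he0]
    have htabs : |t| < s / 8 := by
      have h1 : ‖S (Ψ p) - S (Ψ z)‖ = |t| := by rw [hte, norm_mul, he1, mul_one]; simp
      rw [← h1]
      exact (norm_sub_le _ _).trans_lt (by linarith)
    have hψ' := hψ.filter_mono hle
    have hlim' : ∀ η > 0, ∀ᶠ n in l, ∀ w ∈ Metric.ball z₀ r₀, ‖ψ n w - Ψ w‖ < η :=
      fun η hη => (hlim η hη).filter_mono hle
    rcases le_total 0 t with h0 | h0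
    · rw [abs_of_nonneg h0] at htabs
      refine mem_of_limit_of_steps (ε := ε) Metric.isOpen_ball hψ' hlim' hinj hΨd.continuousOn hJ
        (hA.filter_mono hle) hS hS0 (hε0.filter_mono hle) (hε.mono_left hle) he
        ?_ hz1 hzJ hp1 h0 hte hz2 (by linarith) (by linarith)
      simpa using hstep 1 (by simp) (by simpa using hfwd)
    · rw [abs_of_nonpos h0] at htabs
      refine mem_of_limit_of_steps (ε := fun n => -ε n) (e := -e) (t := -t)
        Metric.isOpen_ball hψ' hlim' hinj hΨd.continuousOn hJ
        (hA.filter_mono hle) hS hS0 ((hε0.filter_mono hle).mono fun n hn => neg_ne_zero.2 hn)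
        (by simpa using (hε.mono_left hle).neg) (by simpa [neg_div] using he.neg)
        ?_ hz1 hzJ hp1 (by linarith) (by push_cast; rw [hte]; ring) hz2 (by linarith) (by linarith)
      simpa using hstep (-1) (by simp) (by simpa using hbwd)
  refine ⟨Metric.ball z₀ ρ, Metric.isOpen_ball, Metric.mem_ball_self hρ,
    fun w => (S (Ψ w) / e).im, (fun w => (S (Ψ w) / e).im) '' (J ∩ Metric.ball z₀ ρ), ?_, ?_, ?_⟩
  · have h1 : DifferentiableOn ℂ (fun w => S (Ψ w) / e) (Metric.ball z₀ ρ) := fun w hw =>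
      (hΘd w hw).choose_spec.2.differentiableAt.differentiableWithinAt
    have h2 : AnalyticOnNhd ℝ (fun w => S (Ψ w) / e) (Metric.ball z₀ ρ) :=
      (h1.analyticOnNhd Metric.isOpen_ball).restrictScalars
    exact fun w hw => (Complex.imCLM.analyticAt _).comp (h2 w hw)
  · intro w hw
    obtain ⟨d, hd0, hd⟩ := hΘd w hw
    have h1 : HasFDerivAt (fun w => (S (Ψ w) / e).im)
        (Complex.imCLM.comp ((ContinuousLinearMap.toSpanSingleton ℂ d).restrictScalars ℝ)) w :=
      Complex.imCLM.hasFDerivAt.comp w (hd.hasFDerivAt.restrictScalars ℝ)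
    rw [h1.fderiv]
    intro y
    refine ⟨(y * Complex.I) / d, ?_⟩
    simp [hd0]
  · ext p
    constructor
    · rintro ⟨hpJ, hp⟩
      exact ⟨hp, p, ⟨hpJ, hp⟩, rfl⟩
    · rintro ⟨hp, z, ⟨hzJ, hz⟩, hzp⟩
      exact ⟨key z hz p hp hzJ hzp, hp⟩

/-! ### Infinite compositions and rescaled windows. -/

/-- The composition `T (n - 1) ∘ ⋯ ∘ T 0`. -/
def iterateSeq (T : ℕ → ℂ → ℂ) : ℕ → ℂ → ℂ
  | 0 => id
  | n + 1 => fun x => T n (iterateSeq T n x)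

/-- Infinite compositions of maps summably close to the identity converge to an injective map. -/
theorem exists_limit_iterateSeq {T : ℕ → ℂ → ℂ} {β : ℕ → ℝ} (hβ0 : ∀ n, 0 ≤ β n)
    (hβ1 : ∀ n, β n ≤ 1 / 2) (hβ : Summable β) (hT0 : ∀ n, T n 0 = 0)
    (hT : ∀ n, ∀ x ∈ Metric.ball (0 : ℂ) (1 / 2), ∀ y ∈ Metric.ball (0 : ℂ) (1 / 2),
      ‖T n x - T n y - (x - y)‖ ≤ β n * ‖x - y‖)
    (hTd : ∀ n, DifferentiableOn ℂ (T n) (Metric.ball 0 (1 / 2))) :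
    ∃ s > 0, s ≤ 1 / 2 ∧ (∀ n, ∀ x ∈ Metric.ball (0 : ℂ) s, ‖iterateSeq T n x‖ < 1 / 2) ∧
      (∀ n, DifferentiableOn ℂ (iterateSeq T n) (Metric.ball 0 s)) ∧
      ∃ Ψ : ℂ → ℂ, Ψ 0 = 0 ∧
        (∀ η > 0, ∀ᶠ n in atTop, ∀ x ∈ Metric.ball (0 : ℂ) s, ‖iterateSeq T n x - Ψ x‖ < η) ∧
        ∃ c > 0, ∀ x ∈ Metric.ball (0 : ℂ) s, ∀ y ∈ Metric.ball (0 : ℂ) s,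
          c * ‖x - y‖ ≤ ‖Ψ x - Ψ y‖ := by
  set b : ℝ := ∑' n, β n with hb
  set Q := iterateSeq T with hQ
  have hQs : ∀ n x, Q (n + 1) x = T n (Q n x) := fun n x => rfl
  have hQ0 : ∀ n, Q n 0 = 0 := by
    intro n
    induction n with
    | zero => rfl
    | succ n ih => rw [hQs, ih, hT0]
  -- Every partial product of the factors `1 + β n` is at most `exp b`, so from this radius all
  -- compositions stay in the ball of radius 1/2.
  set s : ℝ := Real.exp (-b) / 2 with hs
  have hspos : 0 < s := by positivity
  have hb0 : 0 ≤ b := tsum_nonneg hβ0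
  have hpart : ∀ n, ∑ i ∈ Finset.range n, β i ≤ b := fun n => hβ.sum_le_tsum _ fun i _ => hβ0 i
  have hbound : ∀ n, (∀ x ∈ Metric.ball (0 : ℂ) s, ∀ y ∈ Metric.ball (0 : ℂ) s,
      ‖Q n x - Q n y‖ ≤ Real.exp (∑ i ∈ Finset.range n, β i) * ‖x - y‖) →
      ∀ x ∈ Metric.ball (0 : ℂ) s, ‖Q n x‖ < 1 / 2 := by
    intro n h x hx
    have h1 := h x hx 0 (Metric.mem_ball_self hspos)
    rw [hQ0, sub_zero, sub_zero] at h1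
    rw [mem_ball_zero_iff] at hx
    calc ‖Q n x‖ ≤ Real.exp (∑ i ∈ Finset.range n, β i) * ‖x‖ := h1
      _ ≤ Real.exp b * ‖x‖ := by gcongr; exact hpart n
      _ < Real.exp b * s := by gcongr
      _ = 1 / 2 := by rw [hs, mul_div_assoc', ← Real.exp_add]; simp
  have hlip : ∀ n, ∀ x ∈ Metric.ball (0 : ℂ) s, ∀ y ∈ Metric.ball (0 : ℂ) s,
      ‖Q n x - Q n y‖ ≤ Real.exp (∑ i ∈ Finset.range n, β i) * ‖x - y‖ := by
    intro n
    induction n with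
    | zero => intro x _ y _; simp [hQ, iterateSeq]
    | succ n ih =>
      intro x hx y hy
      have h1 := hT n (Q n x) (by simpa using hbound n ih x hx) (Q n y)
        (by simpa using hbound n ih y hy)
      have h2 := norm_add_le (T n (Q n x) - T n (Q n y) - (Q n x - Q n y)) (Q n x - Q n y)
      rw [sub_add_cancel] at h2
      rw [hQs, hQs, Finset.sum_range_succ, Real.exp_add]
      calc ‖T n (Q n x) - T n (Q n y)‖ ≤ (β n + 1) * ‖Q n x - Q n y‖ := by linarith
        _ ≤ Real.exp (β n) * (Real.exp (∑ i ∈ Finset.range n, β i) * ‖x - y‖) := by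
            gcongr
            · exact Real.add_one_le_exp _
            · exact ih x hx y hy
        _ = _ := by ring
  have hup : ∀ n, ∀ x ∈ Metric.ball (0 : ℂ) s, ‖Q n x‖ < 1 / 2 := fun n => hbound n (hlip n)
  have hlo : ∀ n, ∀ x ∈ Metric.ball (0 : ℂ) s, ∀ y ∈ Metric.ball (0 : ℂ) s,
      Real.exp (-2 * ∑ i ∈ Finset.range n, β i) * ‖x - y‖ ≤ ‖Q n x - Q n y‖ := by
    intro n x hx y hy
    induction n with
    | zero => simp [hQ, iterateSeq]
    | succ n ih =>
      have h1 := hT n (Q n x) (by simpa using hup n x hx) (Q n y)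
        (by simpa using hup n y hy)
      have h2 := norm_sub_le (T n (Q n x) - T n (Q n y)) (T n (Q n x) - T n (Q n y) - (Q n x - Q n y))
      rw [sub_sub_cancel] at h2
      rw [hQs, hQs, Finset.sum_range_succ, mul_add, Real.exp_add]
      -- Here `β n ≤ 1 / 2` matters: it bounds the lower Lipschitz factors below by exponentials of
      -- a convergent sum.
      have h3 : Real.exp (-2 * β n) ≤ 1 - β n := by
        have h4 : 1 / (1 - β n) ≤ Real.exp (2 * β n) := by
          have h5 := Real.add_one_le_exp (2 * β n)
          refine le_trans ?_ h5
          rw [div_le_iff₀ (by linarith [hβ1 n])]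
          nlinarith [hβ0 n, hβ1 n]
        rw [show -2 * β n = -(2 * β n) by ring, Real.exp_neg]
        rw [div_le_iff₀ (by linarith [hβ1 n])] at h4
        exact (inv_le_iff_one_le_mul₀ (Real.exp_pos _)).2 (by linarith)
      calc Real.exp (-2 * ∑ i ∈ Finset.range n, β i) * Real.exp (-2 * β n) * ‖x - y‖
          = Real.exp (-2 * β n) * (Real.exp (-2 * ∑ i ∈ Finset.range n, β i) * ‖x - y‖) := by ring
        _ ≤ (1 - β n) * ‖Q n x - Q n y‖ := by
            gcongr
            linarith [hβ1 n]
        _ ≤ _ := by linarith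
  have hdist : ∀ x ∈ Metric.ball (0 : ℂ) s, ∀ n, dist (Q n x) (Q (n + 1) x) ≤ β n := by
    intro x hx n
    have h1 := hT n (Q n x) (by simpa using hup n x hx) 0 (by simp)
    rw [hT0, sub_zero, sub_zero] at h1
    rw [dist_comm, dist_eq_norm, hQs]
    have := hup n x hx
    nlinarith [hβ0 n]
  choose! Ψ hΨ using fun (x : ℂ) (hx : x ∈ Metric.ball (0 : ℂ) s) =>
    cauchySeq_tendsto_of_complete (cauchySeq_of_dist_le_of_summable β (hdist x hx) hβ)
  refine ⟨s, hspos, ?_, hup, ?_, Ψ, ?_, ?_, Real.exp (-2 * b), by positivity, ?_⟩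
  · rw [hs]
    have : Real.exp (-b) ≤ 1 := Real.exp_le_one_iff.2 (by linarith)
    linarith
  · intro n
    induction n with
    | zero => exact differentiableOn_id
    | succ n ih =>
      exact (hTd n).comp ih fun x hx => by simpa using hup n x hx
  · have h0 : (0 : ℂ) ∈ Metric.ball (0 : ℂ) s := Metric.mem_ball_self hspos
    exact tendsto_nhds_unique (hΨ 0 h0) (by simp [hQ0])
  · intro η hη
    have h1 := (tendsto_sum_nat_add β).eventually (gt_mem_nhds hη)
    filter_upwards [h1] with n hn x hx
    have h2 := dist_le_tsum_of_dist_le_of_tendsto β (hdist x hx) hβ (hΨ x hx) n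
    rw [dist_eq_norm] at h2
    refine h2.trans_lt ?_
    simpa [add_comm] using hn
  · intro x hx y hy
    have h1 := ((hΨ x hx).sub (hΨ y hy)).norm
    refine ge_of_tendsto' h1 fun n => le_trans ?_ (hlo n x hx y hy)
    gcongr ?_ * ‖x - y‖
    exact Real.exp_le_exp.2 (by linarith [hpart n])

/-- In the window `z + z ^ (k + 1) * ζ`, `‖ζ‖ ≤ 1 / 2`, the derivative of a germ of order `k`,
rescaled at the source and at the target, is summably close to `1`. -/
theorem window_estimate {f φ : ℂ → ℂ} {k : ℕ} (hφ : AnalyticAt ℂ φ 0)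
    (hf : ∀ᶠ z in 𝓝 0, f z = z + z ^ (k + 1) * φ z) (h0 : 1 + 0 ^ k * φ 0 ≠ 0) :
    ∃ C > 0, ∃ r > 0, ∀ z : ℂ, z ≠ 0 → ‖z‖ < r → ∀ ζ : ℂ, ‖ζ‖ ≤ 1 / 2 → f z ≠ 0 ∧
      ‖deriv f (z + z ^ (k + 1) * ζ) * z ^ (k + 1) / f z ^ (k + 1) - 1‖ ≤ C * ‖z‖ ^ (k + 1) := by
  -- Estimates along this product filter are uniform in `ζ`. The point is that f'(y) and (f z /
  -- z)^(k+1) are both 1 + (k+1) z^k φ(z) + O(z^(k+1)).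
  set l : Filter (ℂ × ℂ) := 𝓝 0 ×ˢ 𝓟 (Metric.closedBall 0 (1 / 2)) with hl
  set y : ℂ × ℂ → ℂ := fun p => p.1 + p.1 ^ (k + 1) * p.2 with hy
  have hz : Tendsto (fun p : ℂ × ℂ => p.1) l (𝓝 0) := tendsto_fst
  have hζ : (fun p : ℂ × ℂ => p.2) =O[l] (fun _ => (1 : ℂ)) := by
    refine IsBigO.of_bound (1 / 2) ?_
    have : ∀ᶠ p : ℂ × ℂ in l, p.2 ∈ Metric.closedBall (0 : ℂ) (1 / 2) :=
      tendsto_snd.eventually (eventually_principal.2 fun _ h => h)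
    filter_upwards [this] with p hp
    simpa using hp
  have hyz : (fun p => y p - p.1) =O[l] fun p => p.1 ^ (k + 1) := by
    have := (isBigO_refl (fun p : ℂ × ℂ => p.1 ^ (k + 1)) l).mul hζ
    simpa [hy] using this
  have hzO : (fun p : ℂ × ℂ => p.1) =O[l] (fun _ => (1 : ℂ)) := hz.isBigO_one ℂ
  have hpow : ∀ i j : ℕ, j ≤ i → (fun p : ℂ × ℂ => p.1 ^ i) =O[l] fun p => p.1 ^ j := by
    intro i j hij
    obtain ⟨m, rfl⟩ := Nat.exists_eq_add_of_le hij
    have := (isBigO_refl (fun p : ℂ × ℂ => p.1 ^ j) l).mul (hzO.pow m)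
    simpa [pow_add] using this
  have hpow1 : ∀ i : ℕ, 1 ≤ i → (fun p : ℂ × ℂ => p.1 ^ i) =O[l] fun p => p.1 := by
    intro i hi
    simpa using hpow i 1 hi
  have hyO : y =O[l] fun p => p.1 := by
    have := (hyz.trans (hpow1 (k + 1) (by omega))).add (isBigO_refl (fun p : ℂ × ℂ => p.1) l)
    simpa using this
  have hyt : Tendsto y l (𝓝 0) := hyO.trans_tendsto hz
  have hφ0 : (fun x => φ x - φ 0) =O[𝓝 0] fun x => x := by
    simpa using hφ.differentiableAt.isBigO_sub
  have hφy : (fun p => φ (y p) - φ p.1) =O[l] fun p => p.1 := by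
    have h1 := (hφ0.comp_tendsto hyt).trans hyO
    have h2 := hφ0.comp_tendsto hz
    refine (h1.sub h2).congr_left fun p => ?_
    simp
  have hφb : (fun p => φ (y p)) =O[l] (fun _ => (1 : ℂ)) :=
    (hφ.continuousAt.tendsto.comp hyt).isBigO_one ℂ
  have hφzb : (fun p : ℂ × ℂ => φ p.1) =O[l] (fun _ => (1 : ℂ)) :=
    (hφ.continuousAt.tendsto.comp hz).isBigO_one ℂ
  have hφ'b : (fun p => deriv φ (y p)) =O[l] (fun _ => (1 : ℂ)) :=
    (hφ.deriv.continuousAt.tendsto.comp hyt).isBigO_one ℂ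
  have hbin : ∀ j : ℕ, (fun w : ℂ => (1 + w) ^ j - 1 - j * w) =O[𝓝 0] fun w => w ^ 2 := by
    intro j
    induction j with
    | zero => simpa using isBigO_zero _ _
    | succ j ih =>
      have h1 : (fun w : ℂ => ((1 + w) ^ j - 1 - j * w) * (1 + w) + j * w ^ 2) =O[𝓝 0]
          fun w => w ^ 2 := by
        refine IsBigO.add ?_ ((isBigO_refl _ _).const_mul_left _)
        have h2 : (fun w : ℂ => 1 + w) =O[𝓝 0] (fun _ => (1 : ℂ)) :=
          (Continuous.tendsto (by fun_prop) 0).isBigO_one ℂ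
        simpa using ih.mul h2
      refine h1.congr_left fun w => ?_
      push_cast; ring
  have hbin1 : ∀ j : ℕ, (fun w : ℂ => (1 + w) ^ j - 1) =O[𝓝 0] fun w => w := by
    intro j
    have h1 : (fun w : ℂ => w ^ 2) =O[𝓝 0] fun w => w := by
      have h2 : (fun w : ℂ => w) =O[𝓝 0] (fun _ => (1 : ℂ)) :=
        (Continuous.tendsto (by fun_prop) 0).isBigO_one ℂ
      simpa [sq] using (isBigO_refl (fun w : ℂ => w) (𝓝 0)).mul h2
    refine (((hbin j).trans h1).add ((isBigO_refl (fun w : ℂ => w) (𝓝 0)).const_mul_left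
      (j : ℂ))).congr_left fun w => ?_
    ring
  have hyk : (fun p => y p ^ k - p.1 ^ k) =O[l] fun p => p.1 ^ (k + 1) := by
    rcases Nat.eq_zero_or_pos k with rfl | hk
    · simpa using isBigO_zero _ _
    · have hw : Tendsto (fun p : ℂ × ℂ => p.1 ^ k * p.2) l (𝓝 0) := by
        have h1 : (fun p : ℂ × ℂ => p.1 ^ k * p.2) =O[l] fun p => p.1 := by
          simpa using (hpow1 k hk).mul hζ
        exact h1.trans_tendsto hz
      have h1 := (hbin1 k).comp_tendsto hw
      have h2 : (fun p : ℂ × ℂ => p.1 ^ k * p.2) =O[l] fun p => p.1 ^ k := by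
        simpa using (isBigO_refl (fun p : ℂ × ℂ => p.1 ^ k) l).mul hζ
      have h3 := (isBigO_refl (fun p : ℂ × ℂ => p.1 ^ k) l).mul (h1.trans h2)
      refine (h3.congr_left fun p => ?_).trans ((hpow (k + k) (k + 1) (by omega)).congr_left
        fun p => by rw [pow_add])
      simp only [Function.comp, hy]
      rw [mul_sub, ← mul_pow, mul_one]
      congr 2
      ring
  have hd : (fun p => deriv f (y p) - (1 + p.1 ^ k * φ p.1) ^ (k + 1)) =O[l]
      fun p => p.1 ^ (k + 1) := by
    have hderiv : ∀ᶠ x in 𝓝 (0 : ℂ), deriv f x = 1 + ((k + 1) * x ^ k * φ x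
        + x ^ (k + 1) * deriv φ x) := by
      filter_upwards [hf.eventually_nhds, hφ.eventually_analyticAt] with x hx hxa
      have h1 : f =ᶠ[𝓝 x] fun z => z + z ^ (k + 1) * φ z := hx
      rw [h1.deriv_eq]
      have h2 : HasDerivAt (fun z => z + z ^ (k + 1) * φ z)
          (1 + (((k + 1 : ℕ) : ℂ) * x ^ k * φ x + x ^ (k + 1) * deriv φ x)) x :=
        (hasDerivAt_id x).add ((hasDerivAt_pow (k + 1) x).mul hxa.differentiableAt.hasDerivAt)
      rw [h2.deriv]; push_cast; ring
    have hR : (fun p : ℂ × ℂ => (1 + p.1 ^ k * φ p.1) ^ (k + 1) - 1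
        - (k + 1 : ℕ) * (p.1 ^ k * φ p.1)) =O[l] fun p => p.1 ^ (k + 1) := by
      rcases Nat.eq_zero_or_pos k with rfl | hk
      · simpa using isBigO_zero _ _
      · have h1 : (fun p : ℂ × ℂ => p.1 ^ k * φ p.1) =O[l] fun p => p.1 ^ k := by
          simpa using (isBigO_refl (fun p : ℂ × ℂ => p.1 ^ k) l).mul hφzb
        have h2 := (hbin (k + 1)).comp_tendsto ((h1.trans (hpow1 k hk)).trans_tendsto hz)
        refine h2.trans ((h1.pow 2).trans ?_)
        have h3 := hpow (k * 2) (k + 1) (by omega)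
        simpa [pow_mul] using h3
    have hmain : (fun p : ℂ × ℂ => (k + 1) * ((y p ^ k - p.1 ^ k) * φ (y p)
        + p.1 ^ k * (φ (y p) - φ p.1)) + y p ^ (k + 1) * deriv φ (y p)
        - ((1 + p.1 ^ k * φ p.1) ^ (k + 1) - 1 - (k + 1 : ℕ) * (p.1 ^ k * φ p.1))) =O[l]
        fun p => p.1 ^ (k + 1) := by
      refine IsBigO.sub (IsBigO.add (IsBigO.const_mul_left (IsBigO.add ?_ ?_) _) ?_) hR
      · simpa using hyk.mul hφb
      · simpa [pow_succ] using (isBigO_refl (fun p : ℂ × ℂ => p.1 ^ k) l).mul hφy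
      · simpa using (hyO.pow (k + 1)).mul hφ'b
    refine hmain.congr' ?_ EventuallyEq.rfl
    filter_upwards [hyt.eventually hderiv] with p hp
    rw [hp]
    push_cast
    ring
  -- As 0^0 = 1, this limit is f'(0) when k = 0 and 1 when k > 0, which lets one statement serve
  -- both cases.
  have hlim : Tendsto (fun p : ℂ × ℂ => 1 + p.1 ^ k * φ p.1) l (𝓝 (1 + 0 ^ k * φ 0)) :=
    tendsto_const_nhds.add ((hz.pow k).mul (hφ.continuousAt.tendsto.comp hz))
  have hinv : (fun p : ℂ × ℂ => ((1 + p.1 ^ k * φ p.1) ^ (k + 1))⁻¹) =O[l] (fun _ => (1 : ℂ)) :=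
    ((hlim.pow (k + 1)).inv₀ (pow_ne_zero _ h0)).isBigO_one ℂ
  have hfin := hd.mul hinv
  simp only [mul_one] at hfin
  obtain ⟨C, hC, hCb⟩ := hfin.exists_pos
  have hev : ∀ᶠ p : ℂ × ℂ in l, p.1 ≠ 0 → f p.1 ≠ 0 ∧
      ‖deriv f (y p) * p.1 ^ (k + 1) / f p.1 ^ (k + 1) - 1‖ ≤ C * ‖p.1‖ ^ (k + 1) := by
    filter_upwards [hCb.bound, hz.eventually hf, hlim.eventually_ne h0] with p hp hfp hne hp0
    have hfac : f p.1 = p.1 * (1 + p.1 ^ k * φ p.1) := by rw [hfp]; ring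
    refine ⟨by rw [hfac]; exact mul_ne_zero hp0 hne, ?_⟩
    rw [norm_pow] at hp
    refine le_of_eq_of_le (congrArg norm ?_) hp
    rw [hfac, mul_pow, mul_comm (p.1 ^ (k + 1)) ((1 + p.1 ^ k * φ p.1) ^ (k + 1)),
      mul_div_mul_right _ _ (pow_ne_zero _ hp0)]
    field_simp
  rw [hl, eventually_prod_principal_iff] at hev
  obtain ⟨r, hr, hrB⟩ := Metric.eventually_nhds_iff_ball.1 hev
  exact ⟨C, hC, r, hr, fun z hz0 hzr ζ hζ1 =>
    hrB z (by simpa using hzr) ζ (by simpa using hζ1) hz0⟩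

/-! ### Invariant germs and lamination along summable orbits. -/

/-- `h` is an invertible holomorphic germ at `0`, with a representative leaving `J` completely
invariant near `0`. -/
structure InvGerm (J : Set ℂ) (h : ℂ → ℂ) : Prop where
  analyticAt : AnalyticAt ℂ h 0
  map_zero : h 0 = 0
  deriv_ne_zero : deriv h 0 ≠ 0
  invariant : ∀ᶠ z in 𝓝 0, h z ∈ J ↔ z ∈ J

/-- `h y = y + b * y ^ (l + 1) + o(y ^ (l + 1))` at `0`. -/
def LeadingCoeff (h : ℂ → ℂ) (l : ℕ) (b : ℂ) : Prop :=
  Tendsto (fun y => (h y - y) / y ^ (l + 1)) (𝓝[≠] 0) (𝓝 b)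

/-- Maps close to the identity can be inverted, with control on the displacement. -/
theorem exists_preimage_near {H : ℕ → ℂ → ℂ} {ε : ℕ → ℂ} {κ : ℂ → ℂ}
    (hκ : ContinuousOn κ (Metric.closedBall 0 (1 / 2)))
    (hH : ∀ n, DifferentiableOn ℂ (H n) (Metric.ball 0 (1 / 2)))
    (hε : Tendsto ε atTop (𝓝 0))
    (happ : ∀ η > 0, ∀ᶠ n in atTop, ∀ x ∈ Metric.ball (0 : ℂ) (1 / 2),
      ‖H n x - x - ε n * κ x‖ ≤ η * ‖ε n‖) :
    ∀ η > 0, ∀ᶠ n in atTop, ∀ x, ‖x‖ < 1 / 4 →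
      ∃ y, ‖y‖ < 1 / 2 ∧ H n y = x ∧ ‖y - x + ε n * κ x‖ ≤ η * ‖ε n‖ := by
  intro η hη
  obtain ⟨M, hM⟩ := (isCompact_closedBall (0 : ℂ) (1 / 2)).exists_bound_of_continuousOn hκ
  have hM0 : 0 ≤ M := (norm_nonneg _).trans (hM 0 (by simp))
  obtain ⟨δ, hδ, hδ'⟩ := Metric.uniformContinuousOn_iff.1
    ((isCompact_closedBall (0 : ℂ) (1 / 2)).uniformContinuousOn_of_continuous hκ) (η / 2)
    (by positivity)
  have hn : Tendsto (fun n => 5 * (M + 1) * ‖ε n‖) atTop (𝓝 0) := by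
    simpa using hε.norm.const_mul (5 * (M + 1))
  filter_upwards [happ 1 one_pos, happ (η / 2) (by positivity),
    hn.eventually (gt_mem_nhds (by norm_num : (0 : ℝ) < 1 / 4)),
    hn.eventually (gt_mem_nhds hδ)] with n h1 h2 h3 h4 x hx
  have hball : ∀ y ∈ Metric.closedBall x (5 * (M + 1) * ‖ε n‖), ‖y‖ < 1 / 2 := by
    intro y hy
    rw [mem_closedBall_iff_norm] at hy
    have := norm_add_le (y - x) x
    rw [sub_add_cancel] at this
    linarith
  have hxB : x ∈ Metric.ball (0 : ℂ) (1 / 2) := by rw [mem_ball_zero_iff]; linarith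
  -- `H n` displaces points by at most `(M + 1) * ‖ε n‖`. On a circle of 5 times this radius its
  -- values stay at 3 times this distance from `H n x`, so a ball of 3/2 times this radius about `H
  -- n x` is covered, and it contains `x`.
  obtain ⟨y, hy, hyx⟩ : ∃ y ∈ Metric.closedBall x (5 * (M + 1) * ‖ε n‖), H n y = x := by
    rcases eq_or_ne (ε n) 0 with h0 | h0
    · refine ⟨x, by simp [h0], ?_⟩
      have := h1 x hxB
      simp only [h0, zero_mul, sub_zero, norm_zero, mul_zero, norm_le_zero_iff] at this
      exact sub_eq_zero.1 this
    · have hε' : 0 < ‖ε n‖ := norm_pos_iff.2 h0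
      have hρ : 0 < 5 * (M + 1) * ‖ε n‖ := by positivity
      have hdisp : ∀ y ∈ Metric.ball (0 : ℂ) (1 / 2), ‖H n y - y‖ ≤ (M + 1) * ‖ε n‖ := by
        intro y hy
        have h5 := norm_add_le (H n y - y - ε n * κ y) (ε n * κ y)
        rw [sub_add_cancel, norm_mul] at h5
        have h6 := h1 y hy
        have h7 := hM y (Metric.ball_subset_closedBall hy)
        nlinarith
      have hd : DiffContOnCl ℂ (H n) (Metric.ball x (5 * (M + 1) * ‖ε n‖)) := by
        refine ((hH n).mono fun y hy => ?_).diffContOnCl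
        rw [closure_ball x hρ.ne'] at hy
        simpa using hball y hy
      have hsub := ball_subset_image_closedBall_of_le hd hρ
        (m := 3 * (M + 1) * ‖ε n‖) (by positivity) ?_
      · have hx' : x ∈ Metric.ball (H n x) (3 * (M + 1) * ‖ε n‖ / 2) := by
          rw [Metric.mem_ball, dist_eq_norm, norm_sub_rev]
          have := hdisp x hxB
          nlinarith
        exact hsub hx'
      · intro y hy
        have h5 := hdisp y (by simpa using hball y (Metric.sphere_subset_closedBall hy))
        have h6 := hdisp x hxB
        rw [mem_sphere_iff_norm] at hy
        have h7 : y - x = (H n y - H n x) - (H n y - y) + (H n x - x) := by ring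
        have h8 := norm_add_le ((H n y - H n x) - (H n y - y)) (H n x - x)
        have h9 := norm_sub_le (H n y - H n x) (H n y - y)
        rw [← h7, hy] at h8
        linarith
  refine ⟨y, hball y hy, hyx, ?_⟩
  have hyB : y ∈ Metric.ball (0 : ℂ) (1 / 2) := by simpa using hball y hy
  have h5 := h2 y hyB
  have h6 := hδ' x (Metric.ball_subset_closedBall hxB) y (Metric.ball_subset_closedBall hyB) (by
    rw [mem_closedBall_iff_norm] at hy
    rw [dist_comm, dist_eq_norm]; linarith)
  rw [dist_eq_norm] at h6
  have h7 : y - x + ε n * κ x = ε n * (κ x - κ y) - (H n y - y - ε n * κ y) := by rw [hyx]; ring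
  rw [h7]
  refine (norm_sub_le _ _).trans ?_
  rw [norm_mul]
  nlinarith [norm_nonneg (ε n)]

/-- Invariance under a germ `f` of order `k` and germs `h j` of order `l ≥ k`, whose effect on the
scale of `f` becomes small, forces lamination along the orbits of `f` tending to `0`. -/
theorem exists_radius_laminated_of_orbit {J : Set ℂ} (hJ : IsClosed J) {f φ : ℂ → ℂ} {k : ℕ}
    (hfJ : InvGerm J f) (hφ : AnalyticAt ℂ φ 0)
    (hf : ∀ᶠ z in 𝓝 0, f z = z + z ^ (k + 1) * φ z) (h0 : 1 + 0 ^ k * φ 0 ≠ 0) :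
    ∃ r > 0, ∀ z : ℕ → ℂ, (∀ n, z (n + 1) = f (z n)) → z 0 ≠ 0 → (∀ n, ‖z n‖ < r) →
      (Summable fun n => ‖z n‖ ^ (k + 1)) →
      ∀ (l : ℕ) (h : ℕ → ℂ → ℂ) (b : ℕ → ℂ) (B : ℝ), (∀ j, InvGerm J (h j)) →
      (∀ j, LeadingCoeff (h j) l (b j)) → (∀ j, b j ≠ 0) → (∀ j, ‖b j‖ ≤ B) → k ≤ l →
      (k < l ∨ Tendsto b atTop (𝓝 0)) → AnalyticallyLaminatedAt J (z 0) := by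
  obtain ⟨C, hC, r₁, hr₁, hest⟩ := window_estimate hφ hf h0
  obtain ⟨r₂, hr₂, hr₂B⟩ := Metric.eventually_nhds_iff_ball.1
    (hfJ.analyticAt.eventually_analyticAt.and hfJ.invariant)
  -- Window points have modulus at most `2 * ‖z n‖`, hence `r₂ / 2`. The bound `1 / (2 * C)` makes
  -- the Lipschitz errors at most 1/2, as `exists_limit_iterateSeq` demands.
  refine ⟨min (min r₁ (r₂ / 2)) (min 1 (1 / (2 * C))), by positivity, ?_⟩
  intro z hz hz0' hzr hsum l h b B hh hL hb hbB hkl hsmall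
  simp only [lt_min_iff] at hzr
  have hz0 : ∀ n, z n ≠ 0 := by
    intro n
    induction n with
    | zero => exact hz0'
    | succ n ih =>
      rw [hz]; exact (hest (z n) ih (hzr n).1.1 0 (by simp)).1
  have hwin : ∀ (n : ℕ) (ζ : ℂ), ‖ζ‖ ≤ 1 / 2 → ‖z n + z n ^ (k + 1) * ζ‖ ≤ 2 * ‖z n‖ := by
    intro n ζ hζ
    refine (norm_add_le _ _).trans ?_
    rw [norm_mul, norm_pow]
    have h1 : ‖z n‖ ^ (k + 1) ≤ ‖z n‖ :=
      pow_le_of_le_one (norm_nonneg _) (hzr n).2.1.le (by omega)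
    nlinarith [norm_nonneg (z n), norm_nonneg ζ]
  have hwinr : ∀ (n : ℕ) (ζ : ℂ), ‖ζ‖ ≤ 1 / 2 →
      z n + z n ^ (k + 1) * ζ ∈ Metric.ball (0 : ℂ) r₂ := by
    intro n ζ hζ
    rw [mem_ball_zero_iff]
    linarith [hwin n ζ hζ, (hzr n).1.2]
  -- This is `f`, read from the window at `z n` to the window at `z (n + 1)`.
  set T : ℕ → ℂ → ℂ := fun n ζ => (f (z n + z n ^ (k + 1) * ζ) - z (n + 1)) / z (n + 1) ^ (k + 1)
    with hT
  have hTd : ∀ n, ∀ ζ : ℂ, ‖ζ‖ ≤ 1 / 2 → HasDerivAt (T n)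
      (deriv f (z n + z n ^ (k + 1) * ζ) * z n ^ (k + 1) / f (z n) ^ (k + 1)) ζ := by
    intro n ζ hζ
    have h1 := (hr₂B _ (hwinr n ζ hζ)).1.differentiableAt.hasDerivAt
    have h2 : HasDerivAt (fun ζ => z n + z n ^ (k + 1) * ζ) (z n ^ (k + 1)) ζ := by
      simpa using ((hasDerivAt_id ζ).const_mul (z n ^ (k + 1))).const_add (z n)
    have h3 := ((h1.comp ζ h2).sub_const (z (n + 1))).div_const (z (n + 1) ^ (k + 1))
    rw [← hz n]
    exact h3
  obtain ⟨s, hs, hs2, hQb, hQd, Ψ, hΨ0, hΨlim, c, hc, hlow⟩ :=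
    exists_limit_iterateSeq (T := T) (β := fun n => C * ‖z n‖ ^ (k + 1)) (fun n => by positivity)
    (fun n => by
      have h1 : ‖z n‖ ^ (k + 1) ≤ ‖z n‖ :=
        pow_le_of_le_one (norm_nonneg _) (hzr n).2.1.le (by omega)
      have h2 := (hzr n).2.2.le
      calc C * ‖z n‖ ^ (k + 1) ≤ C * (1 / (2 * C)) := by gcongr; exact h1.trans h2
        _ = 1 / 2 := by field_simp)
    (hsum.mul_left C) (fun n => by simp [hT, hz])
    (fun n x hx y hy => by
      have := (convex_ball (0 : ℂ) (1 / 2)).norm_image_sub_le_of_norm_hasDerivWithin_le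
        (f := fun ζ => T n ζ - ζ) (f' := fun ζ => deriv f (z n + z n ^ (k + 1) * ζ) *
          z n ^ (k + 1) / f (z n) ^ (k + 1) - 1) (C := C * ‖z n‖ ^ (k + 1))
        (fun w hw => ((hTd n w (by simpa using (mem_ball_zero_iff.1 hw).le)).sub
          (hasDerivAt_id w)).hasDerivWithinAt)
        (fun w hw => (hest (z n) (hz0 n) (hzr n).1.1 w
          (by simpa using (mem_ball_zero_iff.1 hw).le)).2) hy hx
      rwa [show T n x - T n y - (x - y) = (T n x - x) - (T n y - y) by ring])
    (fun n x hx => (hTd n x (by simpa using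
      (mem_ball_zero_iff.1 hx).le)).differentiableAt.differentiableWithinAt)
  have hQJ : ∀ n, ∀ x ∈ Metric.ball (0 : ℂ) s,
      (z n + z n ^ (k + 1) * iterateSeq T n x ∈ J ↔ z 0 + z 0 ^ (k + 1) * x ∈ J) := by
    intro n x hx
    induction n with
    | zero => rfl
    | succ n ih =>
      rw [← ih, ← (hr₂B _ (hwinr n _ (hQb n x hx).le)).2]
      have : z (n + 1) + z (n + 1) ^ (k + 1) * iterateSeq T (n + 1) x =
          f (z n + z n ^ (k + 1) * iterateSeq T n x) := by
        change z (n + 1) + z (n + 1) ^ (k + 1) * T n (iterateSeq T n x) = _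
        rw [hT]
        simp only
        rw [mul_div_cancel₀ _ (pow_ne_zero _ (hz0 (n + 1)))]
        ring
      rw [this]
  have hzlim : Tendsto z atTop (𝓝 0) := by
    have h1 := hsum.tendsto_atTop_zero
    rw [tendsto_zero_iff_norm_tendsto_zero]
    have h2 : Tendsto (fun n => (‖z n‖ ^ (k + 1)) ^ ((k + 1 : ℕ) : ℝ)⁻¹) atTop (𝓝 0) := by
      have h3 := h1.rpow_const (p := ((k + 1 : ℕ) : ℝ)⁻¹) (Or.inr (by positivity))
      rwa [Real.zero_rpow (by positivity)] at h3
    refine h2.congr fun n => ?_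
    exact Real.pow_rpow_inv_natCast (norm_nonneg _) (by omega)
  -- The expansion of `h j` is valid on a disc depending on `j`, so its window is taken far along
  -- the orbit. The error is measured relative to `‖b j‖` because `b` may tend to 0.
  have hN : ∀ j : ℕ, ∃ N ≥ j, ∀ y : ℂ, ‖y‖ ≤ 2 * ‖z N‖ → AnalyticAt ℂ (h j) y ∧
      (h j y ∈ J ↔ y ∈ J) ∧ (y ≠ 0 → ‖(h j y - y) / y ^ (l + 1) - b j‖ ≤ ‖b j‖ / (j + 1)) := by
    intro j
    have h1 : ∀ᶠ y in 𝓝 (0 : ℂ), AnalyticAt ℂ (h j) y ∧ (h j y ∈ J ↔ y ∈ J) ∧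
        (y ≠ 0 → ‖(h j y - y) / y ^ (l + 1) - b j‖ ≤ ‖b j‖ / (j + 1)) := by
      refine (hh j).analyticAt.eventually_analyticAt.and ((hh j).invariant.and ?_)
      have h2 := Metric.tendsto_nhds.1 (hL j) (‖b j‖ / (j + 1))
        (by have := norm_pos_iff.2 (hb j); positivity)
      rw [eventually_nhdsWithin_iff] at h2
      filter_upwards [h2] with y hy hy0
      have := hy hy0
      rw [dist_eq_norm] at this
      exact this.le
    obtain ⟨ρ, hρ, hρB⟩ := Metric.eventually_nhds_iff_ball.1 h1
    have h2 : Tendsto (fun n => 2 * ‖z n‖) atTop (𝓝 0) := by simpa using hzlim.norm.const_mul 2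
    obtain ⟨N, hN1, hN2⟩ := ((h2.eventually (gt_mem_nhds hρ)).and (eventually_ge_atTop j)).exists
    exact ⟨N, hN2, fun y hy => hρB y (by rw [mem_ball_zero_iff]; linarith)⟩
  choose N hNj hNy using hN
  have hNt : Tendsto N atTop atTop := tendsto_atTop_mono hNj tendsto_id
  have hzN : Tendsto (fun j => z (N j)) atTop (𝓝 0) := hzlim.comp hNt
  set u : ℕ → ℂ := fun j => z (N j) ^ (k + 1) with hu
  have hu0 : ∀ j, u j ≠ 0 := fun j => pow_ne_zero _ (hz0 _)
  -- With y = z + z^(k+1) ζ, b y^(l+1) / z^(k+1) = b z^(l-k) (1 + z^k ζ)^(l+1). The first two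
  -- factors give `ε`, and the last tends to the field `κ` below, which is constant unless k = 0.
  set ε : ℕ → ℂ := fun j => b j * z (N j) ^ (l - k) with hεdef
  have hε0 : ∀ j, ε j ≠ 0 := fun j => mul_ne_zero (hb j) (pow_ne_zero _ (hz0 _))
  have hε : Tendsto ε atTop (𝓝 0) := by
    rcases hsmall with hlt | hb0
    · have h1 : Tendsto (fun j => z (N j) ^ (l - k)) atTop (𝓝 0) := by
        have := hzN.pow (l - k)
        rwa [zero_pow (by omega)] at this
      have h2 : IsBoundedUnder (· ≤ ·) atTop ((fun x => ‖x‖) ∘ b) :=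
        isBoundedUnder_of ⟨B, hbB⟩
      exact isBoundedUnder_le_mul_tendsto_zero h2 h1
    · have := hb0.mul (hzN.pow (l - k))
      rwa [zero_mul] at this
  set κ : ℂ → ℂ := fun ζ => (1 + 0 ^ k * ζ) ^ (l + 1) with hκ
  set H : ℕ → ℂ → ℂ := fun j ζ => (h j (z (N j) + u j * ζ) - z (N j)) / u j with hH
  have hHJ : ∀ j ζ, ‖ζ‖ < 1 / 2 →
      (z (N j) + u j * H j ζ ∈ J ↔ z (N j) + u j * ζ ∈ J) := by
    intro j ζ hζ
    have h1 : z (N j) + u j * H j ζ = h j (z (N j) + u j * ζ) := by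
      rw [hH]
      simp only
      rw [mul_div_cancel₀ _ (hu0 j)]
      ring
    rw [h1]
    exact (hNy j _ (hwin (N j) ζ hζ.le)).2.1
  have hHd : ∀ j, DifferentiableOn ℂ (H j) (Metric.ball 0 (1 / 2)) := by
    intro j ζ hζ
    rw [mem_ball_zero_iff] at hζ
    have h1 := (hNy j _ (hwin (N j) ζ hζ.le)).1.differentiableAt
    have h2 : DifferentiableAt ℂ (fun ζ => h j (z (N j) + u j * ζ)) ζ :=
      DifferentiableAt.comp (g := h j) (f := fun ζ => z (N j) + u j * ζ) ζ h1 (by fun_prop)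
    exact ((h2.sub_const _).div_const _).differentiableWithinAt
  have hκlim : ∀ η > 0, ∀ᶠ j in atTop, ∀ ζ ∈ Metric.ball (0 : ℂ) (1 / 2),
      ‖(1 + z (N j) ^ k * ζ) ^ (l + 1) - κ ζ‖ ≤ η := by
    intro η hη
    rcases Nat.eq_zero_or_pos k with hk | hk
    · refine Eventually.of_forall fun j ζ _ => ?_
      simp [hκ, hk, hη.le]
    · have h1 : Tendsto (fun w : ℂ => (1 + w) ^ (l + 1) - 1) (𝓝 0) (𝓝 0) :=
        Continuous.tendsto' (by fun_prop) 0 0 (by simp)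
      obtain ⟨ρ, hρ, hρB⟩ := Metric.eventually_nhds_iff_ball.1
        (Metric.tendsto_nhds.1 h1 η hη)
      have h2 : Tendsto (fun j => ‖z (N j) ^ k‖) atTop (𝓝 0) := by
        have := (hzN.pow k).norm
        rwa [zero_pow hk.ne', norm_zero] at this
      filter_upwards [h2.eventually (gt_mem_nhds hρ)] with j hj ζ hζ
      have h3 := hρB (z (N j) ^ k * ζ) (by
        rw [mem_ball_zero_iff, norm_mul]
        rw [mem_ball_zero_iff] at hζ
        nlinarith [norm_nonneg ζ, norm_nonneg (z (N j) ^ k)])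
      rw [dist_zero_right] at h3
      simpa [hκ, zero_pow hk.ne'] using h3.le
  have happ : ∀ η > 0, ∀ᶠ j in atTop, ∀ ζ ∈ Metric.ball (0 : ℂ) (1 / 2),
      ‖H j ζ - ζ - ε j * κ ζ‖ ≤ η * ‖ε j‖ := by
    intro η hη
    have h1 : Tendsto (fun j : ℕ => 2 ^ (l + 1) * (1 / ((j : ℝ) + 1))) atTop (𝓝 0) := by
      simpa using tendsto_one_div_add_atTop_nhds_zero_nat.const_mul (2 ^ (l + 1) : ℝ)
    filter_upwards [hκlim (η / 2) (by positivity), h1.eventually (gt_mem_nhds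
      (by positivity : (0 : ℝ) < η / 2))] with j hj1 hj2 ζ hζ
    have hζ' : ‖ζ‖ < 1 / 2 := by simpa using hζ
    set Z := z (N j) with hZ
    set v := 1 + Z ^ k * ζ with hv
    have hZ0 : Z ≠ 0 := hz0 _
    have hzk : ‖Z ^ k * ζ‖ ≤ 1 / 2 := by
      rw [norm_mul, norm_pow]
      have : ‖Z‖ ^ k ≤ 1 := pow_le_one₀ (norm_nonneg _) (hzr _).2.1.le
      nlinarith [norm_nonneg ζ]
    have hv0 : v ≠ 0 := by
      intro h0
      have : Z ^ k * ζ = -1 := by linear_combination h0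
      rw [this] at hzk
      norm_num at hzk
    have hvle : ‖v‖ ≤ 2 := by
      refine (norm_add_le _ _).trans ?_
      rw [norm_one]; linarith
    have hy : Z + u j * ζ = Z * v := by simp only [hu, hv, ← hZ]; ring
    have hy0 : Z + u j * ζ ≠ 0 := by rw [hy]; exact mul_ne_zero hZ0 hv0
    have hq := (hNy j _ (hwin (N j) ζ hζ'.le)).2.2 hy0
    set q := (h j (Z + u j * ζ) - (Z + u j * ζ)) / (Z + u j * ζ) ^ (l + 1) with hqdef
    have hq' : h j (Z + u j * ζ) - (Z + u j * ζ) = q * (Z * v) ^ (l + 1) := by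
      rw [hqdef, ← hy, div_mul_cancel₀ _ (pow_ne_zero _ hy0)]
    have hHζ : H j ζ - ζ = q * Z ^ (l - k) * v ^ (l + 1) := by
      have h2 : H j ζ - ζ = (h j (Z + u j * ζ) - (Z + u j * ζ)) / u j := by
        simp only [hH]
        field_simp [hu0 j]
        ring
      have h3 : Z ^ (l + 1) = Z ^ (l - k) * u j := by
        simp only [hu, ← hZ]
        rw [← pow_add]; congr 1; omega
      rw [h2, hq', mul_pow, h3]
      field_simp [hu0 j]
    have hfin : H j ζ - ζ - ε j * κ ζ =
        Z ^ (l - k) * ((q - b j) * v ^ (l + 1) + b j * (v ^ (l + 1) - κ ζ)) := by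
      rw [hHζ]; simp only [hεdef, ← hZ]; ring
    rw [hfin, norm_mul]
    have hεn : ‖ε j‖ = ‖b j‖ * ‖Z ^ (l - k)‖ := norm_mul _ _
    have h4 : ‖(q - b j) * v ^ (l + 1) + b j * (v ^ (l + 1) - κ ζ)‖ ≤ η * ‖b j‖ := by
      refine (norm_add_le _ _).trans ?_
      rw [norm_mul, norm_mul, norm_pow]
      have h5 : ‖q - b j‖ * ‖v‖ ^ (l + 1) ≤ ‖b j‖ / (j + 1) * 2 ^ (l + 1) := by gcongr
      have h6 : ‖b j‖ / (j + 1) * 2 ^ (l + 1) = ‖b j‖ * (2 ^ (l + 1) * (1 / ((j : ℝ) + 1))) := by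
        ring
      have h7 := hj1 ζ hζ
      nlinarith [norm_nonneg (b j)]
    rw [hεn]
    nlinarith [norm_nonneg (Z ^ (l - k))]
  have hκd : Differentiable ℂ κ := by simp only [hκ]; fun_prop
  set r₀ := s * ‖z 0 ^ (k + 1)‖ with hr₀
  have hu00 : z 0 ^ (k + 1) ≠ 0 := pow_ne_zero _ (hz0 0)
  have hun : 0 < ‖z 0 ^ (k + 1)‖ := norm_pos_iff.2 hu00
  have hx : ∀ w ∈ Metric.ball (z 0) r₀, (w - z 0) / z 0 ^ (k + 1) ∈ Metric.ball (0 : ℂ) s := by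
    intro w hw
    rw [mem_ball_iff_norm] at hw
    rw [mem_ball_zero_iff, norm_div, div_lt_iff₀ hun]
    exact hw
  refine analyticallyLaminatedAt_of_steps (r₀ := r₀) (by positivity)
    (ψ := fun j w => iterateSeq T (N j) ((w - z 0) / z 0 ^ (k + 1)))
    (Ψ := fun w => Ψ ((w - z 0) / z 0 ^ (k + 1))) ?_ ?_ (c := c / ‖z 0 ^ (k + 1)‖) (by positivity)
    ?_ (by simpa using hΨ0) hJ (A := fun j => {ζ | z (N j) + u j * ζ ∈ J}) ?_
    (κ := κ) (r := 1 / 4) (by norm_num) hκd.differentiableOn (by simp [hκ]) (ε := ε)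
    (Eventually.of_forall hε0) hε ?_ ?_
  · refine Eventually.of_forall fun j => ?_
    exact (hQd (N j)).comp (by fun_prop) hx
  · intro η hη
    filter_upwards [hNt.eventually (hΨlim η hη)] with j hj w hw
    exact hj _ (hx w hw)
  · intro w hw w' hw'
    have h1 := hlow _ (hx w hw) _ (hx w' hw')
    rw [← sub_div, sub_sub_sub_cancel_right, norm_div] at h1
    rw [div_mul_eq_mul_div, mul_div_assoc]
    exact h1
  · refine Eventually.of_forall fun j w hw => ?_
    have h1 := hQJ (N j) _ (hx w hw)
    rw [mul_div_cancel₀ _ hu00, add_sub_cancel] at h1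
    exact h1
  · intro η hη
    filter_upwards [happ η hη] with j hj x hxA hxr
    exact ⟨H j x, (hHJ j x (by linarith)).2 hxA, hj x (by rw [mem_ball_zero_iff]; linarith)⟩
  · intro η hη
    filter_upwards [exists_preimage_near hκd.continuous.continuousOn hHd hε happ η hη]
      with j hj x hxA hxr
    obtain ⟨y, hy, hyx, hyη⟩ := hj x hxr
    refine ⟨y, ?_, hyη⟩
    rw [← hyx] at hxA
    exact (hHJ j y hy).1 hxA

/-! ### Summable orbits of contracting and parabolic germs. -/

/-- Orbits of a contracting germ are summable. -/
theorem exists_radius_orbit_summable_of_contracting {f : ℂ → ℂ} (hf : DifferentiableAt ℂ f 0)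
    (hf0 : f 0 = 0) (hd : ‖deriv f 0‖ < 1) {r : ℝ} (hr : 0 < r) :
    ∃ ρ > 0, ∀ z : ℂ, ‖z‖ < ρ → (∀ n, ‖f^[n] z‖ < r) ∧ Summable fun n => ‖f^[n] z‖ ^ (0 + 1) := by
  obtain ⟨q, hq1, hq2⟩ := exists_between hd
  have hq0 : 0 ≤ q := (norm_nonneg _).trans hq1.le
  have h1 : ∀ᶠ z in 𝓝 (0 : ℂ), ‖f z‖ ≤ q * ‖z‖ := by
    have h2 := (hasDerivAt_iff_isLittleO.1 hf.hasDerivAt).bound (sub_pos.2 hq1)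
    filter_upwards [h2] with z hz
    simp only [hf0, sub_zero, smul_eq_mul] at hz
    have h3 := norm_add_le (f z - z * deriv f 0) (z * deriv f 0)
    rw [sub_add_cancel, norm_mul] at h3
    nlinarith [norm_nonneg z]
  obtain ⟨ρ, hρ, hρB⟩ := Metric.eventually_nhds_iff_ball.1 h1
  refine ⟨min ρ r, by positivity, fun z hz => ?_⟩
  rw [lt_min_iff] at hz
  have h2 : ∀ n, ‖f^[n] z‖ ≤ q ^ n * ‖z‖ := by
    intro n
    induction n with
    | zero => simp
    | succ n ih =>
      have h3 : ‖f^[n] z‖ ≤ ‖z‖ := ih.trans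
        (mul_le_of_le_one_left (norm_nonneg _) (pow_le_one₀ hq0 hq2.le))
      rw [Function.iterate_succ_apply']
      refine (hρB _ (by rw [mem_ball_zero_iff]; linarith)).trans ?_
      calc q * ‖f^[n] z‖ ≤ q * (q ^ n * ‖z‖) := by gcongr
        _ = _ := by ring
  refine ⟨fun n => (h2 n).trans_lt (lt_of_le_of_lt
    (mul_le_of_le_one_left (norm_nonneg _) (pow_le_one₀ hq0 hq2.le)) hz.2), ?_⟩
  refine Summable.of_nonneg_of_le (fun n => by positivity) (fun n => ?_)
    ((summable_geometric_of_lt_one hq0 hq2).mul_right ‖z‖)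
  simpa using h2 n

/-- A translation to the right from the right half-plane satisfies |Z + t|² ≥ |Z|² + t², and 2
(5/8)² < 1 gives |Z + t| ≥ (5/8)(|Z| + t). The error t/8 leaves the factor 1/2. This keeps parabolic
orbits near 0 and makes them converge at a definite rate. -/
theorem half_le_norm_of_near_translate {Z W : ℂ} {t : ℝ} (ht : 0 ≤ t) (hZ : 0 ≤ Z.re)
    (hW : ‖W - Z - t‖ ≤ t / 8) : (‖Z‖ + t) / 2 ≤ ‖W‖ := by
  have h1 : ‖Z + t‖ ^ 2 ≥ ‖Z‖ ^ 2 + t ^ 2 := by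
    rw [Complex.sq_norm, Complex.sq_norm, Complex.normSq_apply, Complex.normSq_apply]
    simp
    nlinarith
  have h2 : 5 / 8 * ‖Z‖ + 5 / 8 * t ≤ ‖Z + t‖ := by
    refine le_of_sq_le_sq ?_ (norm_nonneg _)
    nlinarith [sq_nonneg (‖Z‖ - t), sq_nonneg (‖Z‖ + t)]
  have h3 := norm_sub_le W (W - Z - t)
  rw [show W - (W - Z - t) = Z + t by ring] at h3
  linarith [norm_nonneg Z]

/-- In the coordinate `-1 / (k a z ^ k)`, a parabolic germ is asymptotic to the unit translation. -/
theorem tendsto_parabolic_coordinate {f : ℂ → ℂ} {k : ℕ} (hk : k ≠ 0) {a : ℂ} (ha : a ≠ 0)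
    (hf : LeadingCoeff f k a) :
    (∀ᶠ z in 𝓝[≠] (0 : ℂ), f z ≠ 0) ∧
    Tendsto (fun z => -(k * a * f z ^ k)⁻¹ - -(k * a * z ^ k)⁻¹) (𝓝[≠] 0) (𝓝 1) := by
  set q : ℂ → ℂ := fun z => (f z - z) / z ^ (k + 1) with hq
  set w : ℂ → ℂ := fun z => z ^ k * q z with hw
  have hz : Tendsto (fun z : ℂ => z ^ k) (𝓝[≠] 0) (𝓝 0) := by
    refine ((continuous_pow k).tendsto' 0 0 (zero_pow hk)).mono_left nhdsWithin_le_nhds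
  have hwt : Tendsto w (𝓝[≠] 0) (𝓝 0) := by simpa using hz.mul hf
  have hne : ∀ᶠ z in 𝓝[≠] (0 : ℂ), z ≠ 0 := self_mem_nhdsWithin
  have hq0 : ∀ᶠ z in 𝓝[≠] (0 : ℂ), q z ≠ 0 := hf.eventually_ne ha
  have h1w : ∀ᶠ z in 𝓝[≠] (0 : ℂ), 1 + w z ≠ 0 := by
    have : Tendsto (fun z => 1 + w z) (𝓝[≠] 0) (𝓝 (1 + 0)) := tendsto_const_nhds.add hwt
    exact this.eventually_ne (by simp)
  have hfz : ∀ z : ℂ, z ≠ 0 → f z = z * (1 + w z) := by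
    intro z hz0
    simp only [hw, hq]
    field_simp
    ring
  refine ⟨?_, ?_⟩
  · filter_upwards [hne, h1w] with z hz0 hz1
    rw [hfz z hz0]; exact mul_ne_zero hz0 hz1
  -- Writing f z = z (1 + w) with w = z^k q, the increment of the coordinate is -(k a)⁻¹ q times the
  -- slope of (1 + x)^(-k) between 0 and w. Here q → a and the slope tends to -k.
  · have hd : HasDerivAt (fun x : ℂ => ((1 + x) ^ k)⁻¹) (-k) 0 := by
      have h2 : HasDerivAt (fun x : ℂ => (1 + x) ^ k) (k * (1 + 0) ^ (k - 1) * 1) 0 :=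
        ((hasDerivAt_id (0 : ℂ)).const_add 1).pow k
      have h3 := h2.inv (by simp)
      simp only [add_zero, one_pow, mul_one, div_one] at h3
      exact h3
    have hsl : Tendsto (fun z => slope (fun x : ℂ => ((1 + x) ^ k)⁻¹) 0 (w z)) (𝓝[≠] 0) (𝓝 (-k)) := by
      refine hd.tendsto_slope.comp (tendsto_nhdsWithin_iff.2 ⟨hwt, ?_⟩)
      filter_upwards [hne, hq0] with z hz0 hz1
      exact mul_ne_zero (pow_ne_zero _ hz0) hz1
    have h4 : Tendsto (fun z => -(k * a)⁻¹ * (q z *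
        slope (fun x : ℂ => ((1 + x) ^ k)⁻¹) 0 (w z))) (𝓝[≠] 0) (𝓝 (-(k * a)⁻¹ * (a * -k))) :=
      (hf.mul hsl).const_mul _
    have hk' : (k : ℂ) ≠ 0 := by exact_mod_cast hk
    have h5 : -((k : ℂ) * a)⁻¹ * (a * -k) = 1 := by field_simp
    rw [h5] at h4
    refine h4.congr' ?_
    filter_upwards [hne, hq0, h1w] with z hz0 hz1 hz2
    have hw0 : w z = z ^ k * q z := rfl
    rw [hfz z hz0, slope_def_field]
    have hzk : z ^ k ≠ 0 := pow_ne_zero _ hz0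
    have h1wk : (1 + w z) ^ k ≠ 0 := pow_ne_zero _ hz2
    rw [mul_pow]
    simp only [add_zero, one_pow, inv_one, sub_zero]
    rw [hw0] at h1wk ⊢
    field_simp
    ring

/-- Orbits of a parabolic germ starting in an attracting half-plane are summable. -/
theorem exists_radius_orbit_summable_of_parabolic {f : ℂ → ℂ} {k : ℕ} (hk : k ≠ 0) {a : ℂ}
    (ha : a ≠ 0) (hf : LeadingCoeff f k a) {r : ℝ} (hr : 0 < r) :
    ∃ ρ > 0, ∀ z : ℂ, z ≠ 0 → ‖z‖ < ρ → 0 ≤ (-(k * a * z ^ k)⁻¹).re →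
      (∀ n, ‖f^[n] z‖ < r) ∧ Summable fun n => ‖f^[n] z‖ ^ (k + 1) := by
  obtain ⟨h1, h2⟩ := tendsto_parabolic_coordinate hk ha hf
  set Z : ℂ → ℂ := fun z => -(k * a * z ^ k)⁻¹ with hZ
  have hk' : (k : ℂ) ≠ 0 := by exact_mod_cast hk
  have hka : 0 < ‖(k : ℂ) * a‖ := norm_pos_iff.2 (mul_ne_zero hk' ha)
  have h3 := h1.and (Metric.tendsto_nhds.1 h2 (1 / 8) (by norm_num))
  rw [eventually_nhdsWithin_iff] at h3
  obtain ⟨r', hr', hr'B⟩ := Metric.eventually_nhds_iff_ball.1 h3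
  set m := min r r' with hm
  have hm0 : 0 < m := lt_min hr hr'
  have hstep : ∀ z : ℂ, z ≠ 0 → ‖z‖ < m → f z ≠ 0 ∧ ‖Z (f z) - Z z - 1‖ ≤ 1 / 8 := by
    intro z hz hzm
    obtain ⟨h4, h5⟩ := hr'B z (by rw [mem_ball_zero_iff]; exact hzm.trans_le (min_le_right _ _)) hz
    rw [dist_eq_norm] at h5
    exact ⟨h4, h5.le⟩
  have hZn : ∀ z : ℂ, ‖Z z‖ = (‖(k : ℂ) * a‖ * ‖z‖ ^ k)⁻¹ := fun z => by
    simp only [hZ]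
    rw [norm_neg, norm_inv, norm_mul, norm_pow]
  refine ⟨m / 2, by positivity, fun z hz hzρ hre => ?_⟩
  have hz' : 0 < ‖z‖ := norm_pos_iff.2 hz
  -- Since `‖z‖ < m / 2`, a point with `‖y‖ ≥ m` would have `‖Z y‖ < ‖Z z‖ / 2`, which a
  -- near-translate of `Z z` to the right cannot satisfy.
  have hkey : ∀ n : ℕ, ∀ y : ℂ, y ≠ 0 → ‖Z y - Z z - n‖ ≤ n / 8 → ‖y‖ < m := by
    intro n y hy hyZ
    have h4 := half_le_norm_of_near_translate (Z := Z z) (W := Z y) (t := n)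
      (Nat.cast_nonneg n) hre (by exact_mod_cast hyZ)
    by_contra! hym
    have h5 : ‖Z y‖ ≤ (‖(k : ℂ) * a‖ * m ^ k)⁻¹ := by
      rw [hZn]; gcongr
    have h6 : 2 * (‖(k : ℂ) * a‖ * m ^ k)⁻¹ < ‖Z z‖ := by
      rw [hZn, ← inv_inv (2 : ℝ), ← mul_inv]
      refine inv_strictAnti₀ (by positivity) ?_
      have h7 : ‖z‖ ^ k < (m / 2) ^ k := by gcongr
      have h8 : (m / 2) ^ k ≤ 2⁻¹ * m ^ k := by
        rw [div_pow, div_eq_inv_mul]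
        gcongr
        exact le_self_pow₀ (by norm_num) hk
      nlinarith
    have h9 : (0 : ℝ) ≤ n := Nat.cast_nonneg n
    linarith
  have hind : ∀ n : ℕ, f^[n] z ≠ 0 ∧ ‖Z (f^[n] z) - Z z - n‖ ≤ n / 8 := by
    intro n
    induction n with
    | zero => simp [hz]
    | succ n ih =>
      obtain ⟨h4, h5⟩ := hstep _ ih.1 (hkey n _ ih.1 ih.2)
      rw [Function.iterate_succ_apply']
      refine ⟨h4, ?_⟩
      have : Z (f (f^[n] z)) - Z z - (n + 1 : ℕ) =
          (Z (f (f^[n] z)) - Z (f^[n] z) - 1) + (Z (f^[n] z) - Z z - n) := by push_cast; ring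
      rw [this]
      refine (norm_add_le _ _).trans ?_
      push_cast
      linarith [ih.2]
  refine ⟨fun n => (hkey n _ (hind n).1 (hind n).2).trans_le (min_le_left _ _), ?_⟩
  set c := min ‖Z z‖ 1 / 2 with hc
  have hZz : 0 < ‖Z z‖ := by rw [hZn]; positivity
  have hc0 : 0 < c := by positivity
  have hlow : ∀ n : ℕ, c * (n + 1) ≤ ‖Z (f^[n] z)‖ := by
    intro n
    have h4 := half_le_norm_of_near_translate (Z := Z z) (W := Z (f^[n] z)) (t := n)
      (Nat.cast_nonneg n) hre (by exact_mod_cast (hind n).2)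
    refine le_trans ?_ h4
    have h5 : (0 : ℝ) ≤ n := Nat.cast_nonneg n
    have h6 := min_le_left ‖Z z‖ 1
    have h7 := min_le_right ‖Z z‖ 1
    rw [hc]
    nlinarith
  -- Linear growth of `Z` along the orbit gives ‖z_n‖^k = O(1/n), so the power k + 1 is O(n^(-p))
  -- with p > 1.
  set p : ℝ := 1 + 1 / k with hp
  have hk0 : (0 : ℝ) < k := by exact_mod_cast Nat.pos_of_ne_zero hk
  have hp1 : 1 < p := by rw [hp]; linarith [one_div_pos.2 hk0]
  have hsum : Summable fun n : ℕ => (‖(k : ℂ) * a‖ * c)⁻¹ ^ p * (1 / ((n + 1 : ℕ) : ℝ) ^ p) :=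
    ((summable_nat_add_iff 1).2 (Real.summable_one_div_nat_rpow.2 hp1)).mul_left _
  refine Summable.of_nonneg_of_le (fun n => by positivity) (fun n => ?_) hsum
  set y := f^[n] z with hy
  have hy0 : 0 < ‖y‖ := norm_pos_iff.2 (hind n).1
  have h4 : ‖y‖ ^ k ≤ (‖(k : ℂ) * a‖ * c)⁻¹ * ((n + 1 : ℕ) : ℝ)⁻¹ := by
    have h5 := hlow n
    rw [hZn, ← hy, mul_inv] at h5
    rw [mul_inv, mul_assoc, ← mul_inv]
    have h6 : ‖y‖ ^ k = ((‖y‖ ^ k)⁻¹)⁻¹ := (inv_inv _).symm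
    rw [h6, ← mul_inv]
    refine inv_anti₀ (by positivity) ?_
    push_cast
    calc ‖(k : ℂ) * a‖ * (c * (n + 1)) ≤
        ‖(k : ℂ) * a‖ * (‖(k : ℂ) * a‖⁻¹ * (‖y‖ ^ k)⁻¹) := by gcongr
      _ = (‖y‖ ^ k)⁻¹ := by field_simp
  have h7 : ‖y‖ ^ (k + 1) = (‖y‖ ^ k) ^ p := by
    rw [← Real.rpow_natCast, ← Real.rpow_natCast, ← Real.rpow_mul hy0.le]
    congr 1
    rw [hp]; push_cast; field_simp
  rw [h7]
  calc (‖y‖ ^ k) ^ p ≤ ((‖(k : ℂ) * a‖ * c)⁻¹ * ((n + 1 : ℕ) : ℝ)⁻¹) ^ p :=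
        Real.rpow_le_rpow (by positivity) h4 (by linarith)
    _ = _ := by
      rw [Real.mul_rpow (by positivity) (by positivity), one_div,
        Real.inv_rpow (Nat.cast_nonneg _)]

/-! ### Sectors free of `J` and arguments of multipliers. -/

/-- A set accumulating at `0` whose tangent cone is not everything avoids a sector near `0`. -/
theorem exists_sector_of_posTangentConeAt_ne_univ {J : Set ℂ} (hJ : ∃ᶠ z in 𝓝[≠] (0 : ℂ), z ∈ J)
    (hcone : posTangentConeAt J 0 ≠ univ) :
    ∃ v : ℂ, ‖v‖ = 1 ∧ ∃ δ > 0, ∃ r > 0, ∀ z ∈ J, z ≠ 0 → ‖z‖ < r → δ ≤ ‖z / ‖z‖ - v‖ := by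
  obtain ⟨y, hy⟩ := (ne_univ_iff_exists_notMem _).1 hcone
  -- Accumulation at 0 puts 0 in the cone, with scaling factors all equal to 0.
  have hy0 : y ≠ 0 := by
    rintro rfl
    refine hy (mem_tangentConeAt_of_frequently (𝓝[≠] (0 : ℂ)) (fun _ => 0) id
      (tendsto_id.mono_left nhdsWithin_le_nhds) (by simpa using hJ) ?_)
    simp
  have hyn : (‖y‖ : ℂ) ≠ 0 := by simpa using hy0
  refine ⟨y / ‖y‖, by simp [hy0], ?_⟩
  by_contra! hcon
  have hcon' : ∀ n : ℕ, ∃ z ∈ J, z ≠ 0 ∧ ‖z‖ < 1 / ((n : ℝ) + 1) ∧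
      ‖z / ‖z‖ - y / ‖y‖‖ < 1 / ((n : ℝ) + 1) := fun n =>
    hcon _ Nat.one_div_pos_of_nat _ Nat.one_div_pos_of_nat
  choose z hzJ hz0 hz1 hz2 using hcon'
  have hlim : Tendsto (fun n => z n / ‖z n‖) atTop (𝓝 (y / ‖y‖)) := by
    rw [tendsto_iff_norm_sub_tendsto_zero]
    exact squeeze_zero (fun n => norm_nonneg _) (fun n => (hz2 n).le)
      tendsto_one_div_add_atTop_nhds_zero_nat
  refine hy (mem_tangentConeAt_of_seq atTop (fun n => ‖y‖₊ / ‖z n‖₊) z ?_ ?_ ?_)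
  · exact squeeze_zero_norm (fun n => (hz1 n).le) tendsto_one_div_add_atTop_nhds_zero_nat
  · exact Eventually.of_forall fun n => by simpa using hzJ n
  · have h1 := hlim.const_mul (‖y‖ : ℂ)
    rw [mul_div_cancel₀ _ hyn] at h1
    refine h1.congr fun n => ?_
    have : (‖z n‖ : ℂ) ≠ 0 := by simpa using hz0 n
    rw [NNReal.smul_def, Complex.real_smul]
    push_cast
    field_simp

/-- The powers of a unit complex number that is not a root of unity are dense in the circle. -/
theorem exists_pow_mul_near {u : ℂ} (hu : ‖u‖ = 1) (hroot : ∀ q : ℕ, q ≠ 0 → u ^ q ≠ 1)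
    {w v : ℂ} (hw : ‖w‖ = 1) (hv : ‖v‖ = 1) {δ : ℝ} (hδ : 0 < δ) :
    ∃ m : ℕ, ‖u ^ m * w - v‖ < δ := by
  obtain ⟨g, hg⟩ : ∃ g : Circle, (g : ℂ) = u := ⟨⟨u, mem_sphere_zero_iff_norm.2 hu⟩, rfl⟩
  obtain ⟨w', hw'⟩ : ∃ g : Circle, (g : ℂ) = w := ⟨⟨w, mem_sphere_zero_iff_norm.2 hw⟩, rfl⟩
  obtain ⟨v', hv'⟩ : ∃ g : Circle, (g : ℂ) = v := ⟨⟨v, mem_sphere_zero_iff_norm.2 hv⟩, rfl⟩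
  obtain ⟨θ, rfl⟩ := Circle.exp_surjective g
  have hirr : Irrational (θ / (2 * Real.pi)) := by
    rintro ⟨p, hp⟩
    have hpi : (2 * Real.pi) ≠ 0 := by positivity
    have hden : (p.den : ℝ) ≠ 0 := by exact_mod_cast p.den_ne_zero
    refine hroot p.den p.den_ne_zero ?_
    rw [← hg, ← Circle.coe_pow, ← Circle.exp_nsmul]
    have : p.den • θ = p.num * (2 * Real.pi) := by
      rw [eq_div_iff hpi] at hp
      rw [nsmul_eq_mul, ← hp, ← mul_assoc]
      congr 1
      exact_mod_cast Rat.den_mul_eq_num p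
    rw [this, Circle.exp_int_mul_two_pi]
    rfl
  have hdense : DenseRange (fun m : ℤ => (Circle.exp θ) ^ m) := by
    have h1 := dense_addSubgroupClosure_pair_iff.2 hirr
    have h2 := (Circle.exp_surjective.denseRange).dense_image Circle.exp.continuous h1
    refine h2.mono ?_
    rintro _ ⟨x, hx, rfl⟩
    obtain ⟨m, n, rfl⟩ := AddSubgroup.mem_closure_pair.1 hx
    refine ⟨m, ?_⟩
    simp only [Circle.exp_add, zsmul_eq_mul, Circle.exp_int_mul_two_pi, mul_one]
    rw [← zsmul_eq_mul, Circle.exp_zsmul]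
  rw [denseRange_zpow_iff_pow] at hdense
  obtain ⟨m, hm⟩ := hdense.exists_dist_lt (v' / w') hδ
  refine ⟨m, ?_⟩
  rw [dist_comm] at hm
  change dist ((Circle.exp θ ^ m : Circle) : ℂ) ((v' / w' : Circle) : ℂ) < δ at hm
  rw [dist_eq_norm] at hm
  have hw0 : w ≠ 0 := by rintro rfl; simp at hw
  have h3 : u ^ m * w - v = (u ^ m - v / w) * w := by field_simp
  rw [h3, norm_mul, hw, mul_one, ← hg, ← hv', ← hw']
  simpa using hm

theorem InvGerm.comp {J : Set ℂ} {g h : ℂ → ℂ} (hg : InvGerm J g) (hh : InvGerm J h) :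
    InvGerm J (g ∘ h) := by
  have h0 : AnalyticAt ℂ g (h 0) := by rw [hh.map_zero]; exact hg.analyticAt
  refine ⟨h0.comp hh.analyticAt, by simp [hh.map_zero, hg.map_zero], ?_, ?_⟩
  · rw [deriv_comp 0 h0.differentiableAt hh.analyticAt.differentiableAt, hh.map_zero]
    exact mul_ne_zero hg.deriv_ne_zero hh.deriv_ne_zero
  · have h1 : Tendsto h (𝓝 0) (𝓝 0) := by
      simpa [ContinuousAt, hh.map_zero] using hh.analyticAt.continuousAt
    filter_upwards [hh.invariant, h1.eventually hg.invariant] with z hz1 hz2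
    exact hz2.trans hz1

theorem InvGerm.id (J : Set ℂ) : InvGerm J id :=
  ⟨analyticAt_id, rfl, by simp, Eventually.of_forall fun _ => Iff.rfl⟩

theorem InvGerm.iterate {J : Set ℂ} {h : ℂ → ℂ} (hh : InvGerm J h) (n : ℕ) :
    InvGerm J h^[n] := by
  induction n with
  | zero => exact InvGerm.id J
  | succ n ih => rw [Function.iterate_succ]; exact ih.comp hh

theorem InvGerm.tendsto {J : Set ℂ} {h : ℂ → ℂ} (hh : InvGerm J h) : Tendsto h (𝓝 0) (𝓝 0) := by
  simpa [ContinuousAt, hh.map_zero] using hh.analyticAt.continuousAt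

theorem InvGerm.eventually_ne_zero {J : Set ℂ} {h : ℂ → ℂ} (hh : InvGerm J h) :
    ∀ᶠ z in 𝓝[≠] 0, h z ≠ 0 := by
  have := hh.analyticAt.differentiableAt.hasDerivAt.eventually_ne hh.deriv_ne_zero (c := 0)
  exact this

theorem InvGerm.deriv_iterate {J : Set ℂ} {h : ℂ → ℂ} (hh : InvGerm J h) (n : ℕ) :
    deriv h^[n] 0 = deriv h 0 ^ n :=
  (HasDerivAt.iterate (x := (0 : ℂ)) hh.analyticAt.differentiableAt.hasDerivAt hh.map_zero n).deriv

/-- If an invariant set avoids a sector and accumulates at `0`, then some power of the multiplier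
is a positive real number. -/
theorem exists_pow_multiplier_eq_norm {J : Set ℂ} {f : ℂ → ℂ} (hf : InvGerm J f)
    (hJ : ∃ᶠ z in 𝓝[≠] (0 : ℂ), z ∈ J) {v : ℂ} (hv : ‖v‖ = 1) {δ : ℝ} (hδ : 0 < δ) {r : ℝ}
    (hr : 0 < r) (hsec : ∀ z ∈ J, z ≠ 0 → ‖z‖ < r → δ ≤ ‖z / ‖z‖ - v‖) :
    ∃ q : ℕ, q ≠ 0 ∧ deriv f 0 ^ q = (‖deriv f 0‖ ^ q : ℝ) := by
  set a := deriv f 0 with ha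
  have ha0 : a ≠ 0 := hf.deriv_ne_zero
  have han : (‖a‖ : ℂ) ≠ 0 := by simpa using ha0
  by_contra! hcon
  have hroot : ∀ q : ℕ, q ≠ 0 → (a / ‖a‖) ^ q ≠ 1 := by
    intro q hq h1
    refine hcon q hq ?_
    rw [div_pow, div_eq_one_iff_eq (pow_ne_zero _ han)] at h1
    rw [h1]; push_cast; rfl
  have hne : (𝓝[≠] (0 : ℂ) ⊓ 𝓟 J).NeBot := frequently_mem_iff_neBot.1 hJ
  set l : Ultrafilter ℂ := Ultrafilter.of (𝓝[≠] (0 : ℂ) ⊓ 𝓟 J) with hl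
  have hl1 : (l : Filter ℂ) ≤ 𝓝[≠] 0 := (Ultrafilter.of_le _).trans inf_le_left
  have hl2 : ∀ᶠ z in (l : Filter ℂ), z ∈ J :=
    (Ultrafilter.of_le (𝓝[≠] (0 : ℂ) ⊓ 𝓟 J)).trans inf_le_right (mem_principal_self J)
  have hl0 : ∀ᶠ z in (l : Filter ℂ), z ≠ 0 := hl1 self_mem_nhdsWithin
  obtain ⟨w, hw, hwl⟩ : ∃ w : ℂ, ‖w‖ = 1 ∧ Tendsto (fun z : ℂ => z / ‖z‖) l (𝓝 w) := by
    have hmem : (l.map (fun z : ℂ => z / ‖z‖) : Filter ℂ) ≤ 𝓟 (Metric.sphere (0 : ℂ) 1) := by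
      rw [le_principal_iff]
      change (fun z : ℂ => z / (‖z‖ : ℂ)) ⁻¹' Metric.sphere (0 : ℂ) 1 ∈ (l : Filter ℂ)
      filter_upwards [hl0] with z hz
      have : ‖z‖ ≠ 0 := by simpa using hz
      simp [this]
    obtain ⟨w, hw, hle⟩ := (isCompact_sphere (0 : ℂ) 1).ultrafilter_le_nhds _ hmem
    exact ⟨w, by simpa using hw, hle⟩
  -- Some iterate rotates the limiting direction `w` of points of `J` to within `δ` of `v`. By
  -- invariance it sends points of `J` into the forbidden sector.
  obtain ⟨m, hm⟩ := exists_pow_mul_near (u := a / ‖a‖) (by simp [ha0]) hroot hw hv hδ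
  have hF := hf.iterate m
  set F := f^[m] with hFdef
  have hslope : Tendsto (fun z => F z / z) (𝓝[≠] 0) (𝓝 (a ^ m)) := by
    have h1 := hF.analyticAt.differentiableAt.hasDerivAt.tendsto_slope
    rw [hFdef, hf.deriv_iterate m] at h1
    refine h1.congr fun z => ?_
    rw [slope_def_field, ← hFdef, hF.map_zero, sub_zero, sub_zero]
  have h2 : Tendsto (fun z => F z / z / ‖F z / z‖ * (z / ‖z‖)) l (𝓝 (a ^ m / ‖a ^ m‖ * w)) := by
    refine Tendsto.mul (Tendsto.div (hslope.mono_left hl1) ?_ (by simpa using fun h => absurd h ha0))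
      hwl
    exact (Complex.continuous_ofReal.tendsto _).comp (hslope.mono_left hl1).norm
  have h3 : ‖a ^ m / ‖a ^ m‖ * w - v‖ < δ := by
    rw [norm_pow]; push_cast; rwa [← div_pow]
  have h4 : ∀ᶠ z in (l : Filter ℂ), ‖F z / z / ‖F z / z‖ * (z / ‖z‖) - v‖ < δ :=
    (h2.sub_const v).norm.eventually (gt_mem_nhds h3)
  have h5 : ∀ᶠ z in (l : Filter ℂ), ‖F z‖ < r := by
    have := hF.tendsto.norm
    rw [norm_zero] at this
    exact (this.mono_left (hl1.trans nhdsWithin_le_nhds)).eventually (gt_mem_nhds hr)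
  have h6 : ∀ᶠ z in (l : Filter ℂ), (F z ∈ J ↔ z ∈ J) :=
    (hl1.trans nhdsWithin_le_nhds) hF.invariant
  have h7 : ∀ᶠ z in (l : Filter ℂ), F z ≠ 0 := hl1 hF.eventually_ne_zero
  obtain ⟨z, h4, h5, h6, h7, h8, h9⟩ := (h4.and (h5.and (h6.and (h7.and (hl0.and hl2))))).exists
  have h10 := hsec (F z) (h6.2 h9) h7 h5
  have h11 : F z / z / ‖F z / z‖ * (z / ‖z‖) = F z / ‖F z‖ := by
    have e1 : (‖z‖ : ℂ) ≠ 0 := by simpa using h8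
    have e2 : (‖F z‖ : ℂ) ≠ 0 := by simpa using h7
    rw [norm_div]; push_cast
    field_simp
  rw [h11] at h4
  linarith

/-! ### Parabolic germs with independent coefficients. -/

/-- A germ `z + e z ^ (k + 1) + ⋯` is, in the coordinate `log z`, a translation by about
`e z ^ k`. -/
theorem eventually_eq_mul_exp {h : ℂ → ℂ} {k : ℕ} (hk : k ≠ 0) {e : ℂ} (hL : LeadingCoeff h k e)
    {η : ℝ} (hη : 0 < η) :
    ∀ᶠ z in 𝓝[≠] (0 : ℂ), ∃ d : ℂ, h z = z * Complex.exp d ∧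
      ‖d - e * z ^ k‖ ≤ η * ‖z‖ ^ k ∧ ‖d‖ ^ 2 ≤ η * ‖z‖ ^ k ∧ ‖d‖ < η := by
  set q : ℂ → ℂ := fun z => (h z - z) / z ^ (k + 1) with hq
  have hz : Tendsto (fun z : ℂ => z ^ k) (𝓝[≠] 0) (𝓝 0) :=
    ((continuous_pow k).tendsto' 0 0 (zero_pow hk)).mono_left nhdsWithin_le_nhds
  have hwt : Tendsto (fun z => z ^ k * q z) (𝓝[≠] 0) (𝓝 0) := by simpa using hz.mul hL
  have hne : ∀ᶠ z in 𝓝[≠] (0 : ℂ), z ≠ 0 := self_mem_nhdsWithin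
  have hqn : Tendsto (fun z => ‖q z - e‖) (𝓝[≠] 0) (𝓝 0) :=
    tendsto_iff_norm_sub_tendsto_zero.1 hL
  have hzn : Tendsto (fun z : ℂ => ‖z‖ ^ k * (‖e‖ + 1) ^ 2 * 4) (𝓝[≠] 0) (𝓝 0) := by
    simpa using (hz.norm.mul_const ((‖e‖ + 1) ^ 2)).mul_const 4
  have hwn : Tendsto (fun z => ‖z ^ k * q z‖) (𝓝[≠] 0) (𝓝 0) := by simpa using hwt.norm
  filter_upwards [hne, hqn.eventually (gt_mem_nhds (by positivity : (0 : ℝ) < min (η / 2) 1)),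
    hzn.eventually (gt_mem_nhds (by positivity : (0 : ℝ) < η)),
    hwn.eventually (gt_mem_nhds (by positivity : (0 : ℝ) < min (1 / 2) (η / 2)))]
    with z hz0 h1 h2 h3
  rw [lt_min_iff] at h1 h3
  set w := z ^ k * q z with hw
  have hw1 : 1 + w ≠ 0 := by
    intro h0
    have : w = -1 := by linear_combination h0
    rw [this] at h3
    norm_num at h3
  have hlog : ‖Complex.log (1 + w) - w‖ ≤ ‖w‖ ^ 2 := by
    refine (Complex.norm_log_one_add_sub_self_le (by linarith [h3.1])).trans ?_
    have : (1 - ‖w‖)⁻¹ ≤ 2 := by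
      rw [inv_le_comm₀ (by linarith) (by norm_num)]
      linarith
    have h4 : ‖w‖ ^ 2 * (1 - ‖w‖)⁻¹ ≤ ‖w‖ ^ 2 * 2 := by gcongr
    linarith
  have hqe : ‖q z‖ ≤ ‖e‖ + 1 := by
    have := norm_add_le (q z - e) e
    rw [sub_add_cancel] at this
    linarith [h1.2]
  have hwle : ‖w‖ ≤ ‖z‖ ^ k * (‖e‖ + 1) := by
    rw [hw, norm_mul, norm_pow]; gcongr
  have hw2 : ‖w‖ ^ 2 ≤ ‖z‖ ^ k * (η / 4) := by
    calc ‖w‖ ^ 2 ≤ (‖z‖ ^ k * (‖e‖ + 1)) ^ 2 := by gcongr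
      _ = ‖z‖ ^ k * (‖z‖ ^ k * (‖e‖ + 1) ^ 2) := by ring
      _ ≤ ‖z‖ ^ k * (η / 4) := by gcongr; linarith
  have hdle : ‖Complex.log (1 + w)‖ ≤ 2 * ‖w‖ := by
    have := norm_add_le (Complex.log (1 + w) - w) w
    rw [sub_add_cancel] at this
    nlinarith [norm_nonneg w]
  refine ⟨Complex.log (1 + w), ?_, ?_, ?_, ?_⟩
  · rw [Complex.exp_log hw1, hw]
    simp only [hq]
    field_simp
    ring
  · have h5 : Complex.log (1 + w) - e * z ^ k = (Complex.log (1 + w) - w) + z ^ k * (q z - e) := by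
      rw [hw]; ring
    rw [h5]
    refine (norm_add_le _ _).trans ?_
    rw [norm_mul, norm_pow]
    have h6 : ‖z‖ ^ k * ‖q z - e‖ ≤ ‖z‖ ^ k * (η / 2) := by gcongr; exact h1.1.le
    have h7 : 0 ≤ ‖z‖ ^ k * η := by positivity
    nlinarith
  · calc ‖Complex.log (1 + w)‖ ^ 2 ≤ (2 * ‖w‖) ^ 2 := by gcongr
      _ = 4 * ‖w‖ ^ 2 := by ring
      _ ≤ _ := by linarith
  · linarith

/-- Taking norms in the identity Re(ξa) b - Re(ξb) a = i Im(āb) ξ̄ gives the bound. When Im(āb) ≠ 0,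
one of a, -a, b, -b then decreases the linear form Re(ξ ·) at a rate proportional to |ξ|. -/
theorem norm_mul_le_of_independent (a b ξ : ℂ) :
    |((starRingEnd ℂ) a * b).im| * ‖ξ‖ ≤ |(ξ * a).re| * ‖b‖ + |(ξ * b).re| * ‖a‖ := by
  have h1 : ((ξ * a).re : ℂ) * b - ((ξ * b).re : ℂ) * a =
      Complex.I * (((starRingEnd ℂ) a * b).im : ℂ) * (starRingEnd ℂ) ξ := by
    apply Complex.ext <;> simp <;> ring
  have h2 := norm_sub_le (((ξ * a).re : ℂ) * b) (((ξ * b).re : ℂ) * a)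
  rw [h1] at h2
  simpa only [norm_mul, Complex.norm_I, one_mul, Complex.norm_real, Real.norm_eq_abs,
    RCLike.norm_conj] using h2

/-- Off a sector around `-1`, the argument stays away from `±π`. -/
theorem abs_arg_le_of_le_norm_add_one {u : ℂ} (hu : u ≠ 0) {δ : ℝ} (hδ : δ ≤ ‖u / ‖u‖ + 1‖) :
    |Complex.arg u| ≤ Real.pi - δ := by
  have hun : (‖u‖ : ℂ) ≠ 0 := by simpa using hu
  set α := Complex.arg u with hα
  have h1 : u / ‖u‖ = Complex.exp (Complex.I * α) := by
    rw [div_eq_iff hun, mul_comm Complex.I, mul_comm]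
    exact (Complex.norm_mul_exp_arg_mul_I u).symm
  have key : ∀ s : ℝ, Complex.exp (Complex.I * s) = -1 → δ ≤ |α - s| := by
    intro s hs
    have h2 : u / ‖u‖ + 1 = -(Complex.exp (Complex.I * (α - s : ℝ)) - 1) := by
      have h3 : Complex.exp (Complex.I * α) =
          Complex.exp (Complex.I * (α - s : ℝ)) * Complex.exp (Complex.I * s) := by
        rw [← Complex.exp_add]; congr 1; push_cast; ring
      rw [h1, h3, hs]; ring
    rw [h2, norm_neg] at hδ
    exact hδ.trans (Real.norm_exp_I_mul_ofReal_sub_one_le)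
  have hp := key Real.pi (by rw [mul_comm]; exact Complex.exp_pi_mul_I)
  have hm := key (-Real.pi) (by
    push_cast
    rw [mul_neg, Complex.exp_neg, mul_comm, Complex.exp_pi_mul_I]; norm_num)
  rw [abs_of_nonpos (by linarith [Complex.arg_le_pi u])] at hp
  rw [abs_of_nonneg (by linarith [Complex.neg_pi_lt_arg u])] at hm
  exact abs_le.2 ⟨by linarith, by linarith⟩

/-- A closed set invariant under two parabolic germs of the same order whose coefficients are
independent over the reals, and avoiding a sector, does not accumulate at `0`. -/
theorem eventually_notMem_of_independent {J : Set ℂ} (hJ : IsClosed J) {k : ℕ} (hk : k ≠ 0)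
    {a b : ℂ} (hab : ((starRingEnd ℂ) a * b).im ≠ 0)
    (hgerm : ∀ e ∈ ({a, -a, b, -b} : Set ℂ), ∃ h, InvGerm J h ∧ LeadingCoeff h k e)
    {v : ℂ} (hv : ‖v‖ = 1) {δ : ℝ} (hδ : 0 < δ) {r : ℝ}
    (hr : 0 < r) (hsec : ∀ z ∈ J, z ≠ 0 → ‖z‖ < r → δ ≤ ‖z / ‖z‖ - v‖) :
    ∀ᶠ z in 𝓝[≠] (0 : ℂ), z ∉ J := by
  have hv0 : v ≠ 0 := by rintro rfl; simp at hv
  have ha0 : a ≠ 0 := by rintro rfl; simp at hab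
  set c := |((starRingEnd ℂ) a * b).im| / (‖a‖ + ‖b‖) with hc
  have han : 0 < ‖a‖ + ‖b‖ := by have := norm_pos_iff.2 ha0; positivity
  have hc0 : 0 < c := div_pos (abs_pos.2 hab) han
  have hdir : ∀ ξ : ℂ, ∃ e ∈ ({a, -a, b, -b} : Set ℂ), (ξ * e).re ≤ -(c * ‖ξ‖) := by
    intro ξ
    have h1 := norm_mul_le_of_independent a b ξ
    have h2 : c * ‖ξ‖ ≤ |(ξ * a).re| ∨ c * ‖ξ‖ ≤ |(ξ * b).re| := by
      by_contra! hcon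
      have h3 : c * ‖ξ‖ * (‖a‖ + ‖b‖) = |((starRingEnd ℂ) a * b).im| * ‖ξ‖ := by
        rw [hc]; field_simp
      have h4 := norm_pos_iff.2 ha0
      nlinarith [norm_nonneg b]
    rcases h2 with h | h
    · rcases le_total 0 (ξ * a).re with h0 | h0
      · rw [abs_of_nonneg h0] at h
        exact ⟨-a, by simp, by rw [mul_neg, Complex.neg_re]; linarith⟩
      · rw [abs_of_nonpos h0] at h
        exact ⟨a, by simp, by linarith⟩
    · rcases le_total 0 (ξ * b).re with h0 | h0
      · rw [abs_of_nonneg h0] at h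
        exact ⟨-b, by simp, by rw [mul_neg, Complex.neg_re]; linarith⟩
      · rw [abs_of_nonpos h0] at h
        exact ⟨b, by simp, by linarith⟩
  -- `c / 4` makes the linear and quadratic errors smaller than the gain, 1 keeps the moved point in
  -- the annulus, and `δ` keeps its logarithm on the principal branch.
  set η := min (c / 4) (min 1 δ) with hη
  have hη0 : 0 < η := by positivity
  have hev : ∀ᶠ z in 𝓝[≠] (0 : ℂ), ∀ e ∈ ({a, -a, b, -b} : Set ℂ), z ∈ J → ∃ d : ℂ,
      z * Complex.exp d ∈ J ∧ ‖d - e * z ^ k‖ ≤ η * ‖z‖ ^ k ∧ ‖d‖ ^ 2 ≤ η * ‖z‖ ^ k ∧ ‖d‖ < η := by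
    rw [eventually_all_finite (by simp)]
    intro e he
    obtain ⟨h, hh, hL⟩ := hgerm e he
    filter_upwards [eventually_eq_mul_exp hk hL hη0, nhdsWithin_le_nhds hh.invariant]
      with z hz hzJ hzmem
    obtain ⟨d, hd, hd'⟩ := hz
    exact ⟨d, hd ▸ hzJ.2 hzmem, hd'⟩
  rw [eventually_nhdsWithin_iff] at hev
  obtain ⟨ρ₁, hρ₁, hρ₁B⟩ := Metric.eventually_nhds_iff_ball.1 hev
  set ρ := min ρ₁ r with hρ
  have hρ0 : 0 < ρ := lt_min hρ₁ hr
  set s : ℂ → ℂ := fun z => Complex.log (-z / v) with hs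
  have hu0 : ∀ z : ℂ, z ≠ 0 → -z / v ≠ 0 := fun z hz => div_ne_zero (neg_ne_zero.2 hz) hv0
  have hsre : ∀ z : ℂ, (s z).re = Real.log ‖z‖ := fun z => by
    simp only [hs]; rw [Complex.log_re, norm_div, norm_neg, hv, div_one]
  have hsim : ∀ z ∈ J, z ≠ 0 → ‖z‖ < ρ → |(s z).im| ≤ Real.pi - δ := by
    intro z hz hz0 hzρ
    simp only [hs]
    rw [Complex.log_im]
    refine abs_arg_le_of_le_norm_add_one (hu0 z hz0) ?_
    have h1 := hsec z hz hz0 (hzρ.trans_le (min_le_right _ _))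
    have h2 : -z / v / ‖-z / v‖ + 1 = -(z / ‖z‖ - v) / v := by
      rw [norm_div, norm_neg, hv, div_one]
      field_simp
      ring
    rwa [h2, norm_div, norm_neg, hv, div_one]
  by_contra hcon
  rw [not_eventually] at hcon
  simp only [not_not] at hcon
  have hsmall : ∀ᶠ z in 𝓝[≠] (0 : ℂ), z ≠ 0 ∧ Real.exp 4 * ‖z‖ < ρ := by
    refine Eventually.and self_mem_nhdsWithin ?_
    have h1 : Tendsto (fun z : ℂ => Real.exp 4 * ‖z‖) (𝓝 0) (𝓝 0) := by
      simpa using (continuous_norm.tendsto (0 : ℂ)).const_mul (Real.exp 4)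
    exact nhdsWithin_le_nhds (h1.eventually (gt_mem_nhds hρ0))
  obtain ⟨z₀, hz₀J, hz₀0, hz₀ρ⟩ := (hcon.and_eventually hsmall).exists
  have hz₀n : 0 < ‖z₀‖ := norm_pos_iff.2 hz₀0
  set x₀ := Real.log ‖z₀‖ with hx₀
  set K : Set ℂ := J ∩ {z | Real.exp (-4) * ‖z₀‖ ≤ ‖z‖ ∧ ‖z‖ ≤ Real.exp 4 * ‖z₀‖} with hK
  have hKc : IsCompact K := by
    refine (isCompact_closedBall (0 : ℂ) (Real.exp 4 * ‖z₀‖)).of_isClosed_subset ?_ ?_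
    · exact hJ.inter ((isClosed_le continuous_const continuous_norm).inter
        (isClosed_le continuous_norm continuous_const))
    · rintro z ⟨-, -, hz⟩
      simpa using hz
  have hK0 : ∀ z ∈ K, z ≠ 0 ∧ ‖z‖ < ρ := by
    rintro z ⟨-, hz1, hz2⟩
    exact ⟨norm_pos_iff.1 (lt_of_lt_of_le (by positivity) hz1), hz2.trans_lt hz₀ρ⟩
  have hKlog : ∀ z ∈ J, z ≠ 0 → |Real.log ‖z‖ - x₀| ≤ 4 → z ∈ K := by
    intro z hzJ hz0 hz
    have hzn : 0 < ‖z‖ := norm_pos_iff.2 hz0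
    rw [abs_le] at hz
    refine ⟨hzJ, ?_, ?_⟩
    · rw [← Real.exp_log hzn, ← Real.exp_log hz₀n, ← Real.exp_add]
      exact Real.exp_le_exp.2 (by linarith [hz.1])
    · rw [← Real.exp_log hzn, ← Real.exp_log hz₀n, ← Real.exp_add]
      exact Real.exp_le_exp.2 (by linarith [hz.2])
  -- In the coordinate `s`, `J` lies in a strip |Im s| ≤ π - δ. The square keeps a minimum of `P` on
  -- `K` off the boundary circles of the annulus, and the term -Im s prevents critical points. At
  -- the minimum one of the four germs moves the point within `J` and decreases `P`, a
  -- contradiction.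
  set P : ℂ → ℝ := fun z => ((s z).re - x₀) ^ 2 - (s z).im with hP
  have hscont : ContinuousOn s K := by
    intro z hz
    obtain ⟨hz0, hzρ⟩ := hK0 z hz
    refine ContinuousWithinAt.clog (by fun_prop) ?_
    rw [Complex.mem_slitPlane_iff_arg]
    have h1 := hsim z hz.1 hz0 hzρ
    simp only [hs] at h1
    rw [Complex.log_im, abs_le] at h1
    exact ⟨by linarith [h1.2], hu0 z hz0⟩
  have hPcont : ContinuousOn P K :=
    (((Complex.continuous_re.comp_continuousOn hscont).sub continuousOn_const).pow 2).sub
      (Complex.continuous_im.comp_continuousOn hscont)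
  have hz₀K : z₀ ∈ K := hKlog z₀ hz₀J hz₀0 (by simp [hx₀])
  obtain ⟨z, hzK, hzmin⟩ := hKc.exists_isMinOn ⟨z₀, hz₀K⟩ hPcont
  obtain ⟨hz0, hzρ⟩ := hK0 z hzK
  -- Comparison with `z₀` bounds the square by 2π - 2δ < 9, whereas `K` extends to distance 4.
  have hx3 : |(s z).re - x₀| < 3 := by
    have h1 : P z ≤ P z₀ := hzmin hz₀K
    have h2 := abs_le.1 (hsim z hzK.1 hz0 hzρ)
    have h3 := abs_le.1 (hsim z₀ hz₀J hz₀0 (hK0 z₀ hz₀K).2)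
    simp only [hP] at h1
    rw [hsre z₀, ← hx₀, sub_self] at h1
    refine abs_lt_of_sq_lt_sq ?_ (by norm_num)
    have := Real.pi_lt_four
    nlinarith [Real.pi_lt_d2]
  -- The differential of `P` in the coordinate `s` is d ↦ Re(Γ d).
  set Γ : ℂ := ⟨2 * ((s z).re - x₀), 1⟩ with hΓ
  have hΓ1 : 1 ≤ ‖Γ‖ := by
    have := Complex.abs_im_le_norm Γ
    simpa [hΓ] using this
  obtain ⟨e, he, hre⟩ := hdir (Γ * z ^ k)
  obtain ⟨d, hdJ, hd1, hd2, hd3⟩ := hρ₁B z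
    (by rw [mem_ball_zero_iff]; exact hzρ.trans_le (min_le_left _ _)) hz0 e he hzK.1
  have hη1 : η ≤ c / 4 := min_le_left _ _
  have hη2 : η ≤ 1 := (min_le_right _ _).trans (min_le_left _ _)
  have hη3 : η ≤ δ := (min_le_right _ _).trans (min_le_right _ _)
  have hsd : s (z * Complex.exp d) = s z + d := by
    have h1 := abs_le.1 (hsim z hzK.1 hz0 hzρ)
    have h2 := abs_lt.1 ((Complex.abs_im_le_norm d).trans_lt (hd3.trans_le hη3))
    have h3 : -(z * Complex.exp d) / v = Complex.exp (s z + d) := by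
      rw [Complex.exp_add]
      simp only [hs]
      rw [Complex.exp_log (hu0 z hz0)]
      ring
    change Complex.log (-(z * Complex.exp d) / v) = s z + d
    rw [h3, Complex.log_exp (by rw [Complex.add_im]; linarith [h1.1, h2.1])
      (by rw [Complex.add_im]; linarith [h1.2, h2.2])]
  have hznew : z * Complex.exp d ≠ 0 := mul_ne_zero hz0 (Complex.exp_ne_zero d)
  have hnewK : z * Complex.exp d ∈ K := by
    refine hKlog _ hdJ hznew ?_
    rw [← hsre, hsd, Complex.add_re, abs_le]
    have h1 := abs_lt.1 hx3
    have h2 := abs_lt.1 ((Complex.abs_re_le_norm d).trans_lt (hd3.trans_le hη2))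
    constructor <;> linarith [h1.1, h1.2, h2.1, h2.2]
  have hmin : P z ≤ P (z * Complex.exp d) := hzmin hnewK
  simp only [hP, hsd, Complex.add_re, Complex.add_im] at hmin
  have hdecomp : 2 * ((s z).re - x₀) * d.re - d.im =
      (Γ * z ^ k * e).re + (Γ * (d - e * z ^ k)).re := by
    rw [← Complex.add_re, show Γ * z ^ k * e + Γ * (d - e * z ^ k) = Γ * d by ring,
      Complex.mul_re]
    simp [hΓ]
  have h1 : (Γ * (d - e * z ^ k)).re ≤ ‖Γ‖ * (η * ‖z‖ ^ k) := by
    refine (Complex.re_le_norm _).trans ?_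
    rw [norm_mul]; gcongr
  have h2 : d.re ^ 2 ≤ ‖d‖ ^ 2 := by
    rw [← sq_abs]; gcongr; exact Complex.abs_re_le_norm d
  rw [norm_mul, norm_pow] at hre
  have hzk : 0 < ‖z‖ ^ k := by have := norm_pos_iff.2 hz0; positivity
  have h3 : ‖Γ‖ * (η * ‖z‖ ^ k) ≤ ‖Γ‖ * (c / 4 * ‖z‖ ^ k) := by gcongr
  have h4 : η * ‖z‖ ^ k ≤ c / 4 * (‖Γ‖ * ‖z‖ ^ k) := by
    have : ‖z‖ ^ k ≤ ‖Γ‖ * ‖z‖ ^ k := le_mul_of_one_le_left hzk.le hΓ1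
    calc η * ‖z‖ ^ k ≤ c / 4 * ‖z‖ ^ k := by gcongr
      _ ≤ _ := by gcongr
  have h5 : 0 < c * (‖Γ‖ * ‖z‖ ^ k) := by positivity
  nlinarith

/-! ### Calculus of leading coefficients, inverses and integer iterates. -/

theorem InvGerm.tendsto_punctured {J : Set ℂ} {h : ℂ → ℂ} (hh : InvGerm J h) :
    Tendsto h (𝓝[≠] 0) (𝓝[≠] 0) :=
  tendsto_nhdsWithin_iff.2 ⟨hh.tendsto.mono_left nhdsWithin_le_nhds, hh.eventually_ne_zero⟩

theorem LeadingCoeff.tendsto_div {h : ℂ → ℂ} {k : ℕ} (hk : k ≠ 0) {b : ℂ}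
    (hL : LeadingCoeff h k b) : Tendsto (fun y => h y / y) (𝓝[≠] 0) (𝓝 1) := by
  have hz : Tendsto (fun z : ℂ => z ^ k) (𝓝[≠] 0) (𝓝 0) :=
    ((continuous_pow k).tendsto' 0 0 (zero_pow hk)).mono_left nhdsWithin_le_nhds
  have h1 : Tendsto (fun y => 1 + y ^ k * ((h y - y) / y ^ (k + 1))) (𝓝[≠] 0) (𝓝 (1 + 0 * b)) :=
    (hz.mul hL).const_add 1
  rw [zero_mul, add_zero] at h1
  refine h1.congr' ?_
  filter_upwards [self_mem_nhdsWithin] with y hy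
  have hy0 : y ≠ 0 := hy
  field_simp
  ring

/-- Split g(h y) - y as (g(h y) - h y) + (h y - y). For k ≠ 0 one has h y / y → 1, so replacing (h
y)^(k+1) by y^(k+1) costs nothing and the coefficients add. For k = 0 the multipliers multiply
instead. -/
theorem leadingCoeff_comp {J : Set ℂ} {g h : ℂ → ℂ} {k : ℕ} (hk : k ≠ 0) {b c : ℂ}
    (hh : InvGerm J h) (hg : LeadingCoeff g k b) (hL : LeadingCoeff h k c) :
    LeadingCoeff (g ∘ h) k (b + c) := by
  have h1 := (((Tendsto.comp hg hh.tendsto_punctured).mul ((hL.tendsto_div hk).pow (k + 1))).add hL)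
  rw [one_pow, mul_one] at h1
  refine h1.congr' ?_
  filter_upwards [self_mem_nhdsWithin, hh.eventually_ne_zero] with y hy hhy
  have hy0 : y ≠ 0 := hy
  simp only [Function.comp, div_pow]
  have hy1 := pow_ne_zero (k + 1) hy0
  have hy2 := pow_ne_zero (k + 1) hhy
  generalize y ^ (k + 1) = Y at *
  generalize h y ^ (k + 1) = Z at *
  field_simp
  ring

theorem leadingCoeff_id (k : ℕ) : LeadingCoeff id k 0 :=
  tendsto_const_nhds.congr fun y => by simp

theorem LeadingCoeff.iterate {J : Set ℂ} {h : ℂ → ℂ} {k : ℕ} (hk : k ≠ 0) {b : ℂ}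
    (hh : InvGerm J h) (hL : LeadingCoeff h k b) (n : ℕ) : LeadingCoeff h^[n] k (n * b) := by
  induction n with
  | zero => simpa using leadingCoeff_id k
  | succ n ih =>
    rw [Function.iterate_succ]
    convert! leadingCoeff_comp hk hh ih hL using 1
    push_cast; ring

theorem LeadingCoeff.congr {g h : ℂ → ℂ} {k : ℕ} {b : ℂ} (hgh : g =ᶠ[𝓝 0] h)
    (hg : LeadingCoeff g k b) : LeadingCoeff h k b :=
  Tendsto.congr' (by filter_upwards [nhdsWithin_le_nhds hgh] with y hy; rw [hy]) hg

theorem LeadingCoeff.of_hasDerivAt {h : ℂ → ℂ} {d : ℂ} (h0 : h 0 = 0) (hd : HasDerivAt h d 0) :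
    LeadingCoeff h 0 (d - 1) := by
  refine (hd.tendsto_slope.sub_const 1).congr' ?_
  filter_upwards [self_mem_nhdsWithin] with y hy
  have hy0 : y ≠ 0 := hy
  rw [slope_def_field, h0]
  field_simp
  ring

theorem LeadingCoeff.of_factor {h φ : ℂ → ℂ} {l : ℕ} (hφ : ContinuousAt φ 0)
    (hh : ∀ᶠ z in 𝓝 0, h z = z + z ^ (l + 1) * φ z) : LeadingCoeff h l (φ 0) := by
  refine (hφ.tendsto.mono_left nhdsWithin_le_nhds).congr' ?_
  filter_upwards [self_mem_nhdsWithin, nhdsWithin_le_nhds hh] with y hy hhy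
  have hy0 : y ≠ 0 := hy
  rw [hhy]
  field_simp
  ring

/-- A holomorphic germ with a given leading coefficient is the identity or factors with a nonzero
coefficient of at least that order. -/
theorem LeadingCoeff.exists_factor {h : ℂ → ℂ} {k : ℕ} {a : ℂ} (hh : AnalyticAt ℂ h 0)
    (hL : LeadingCoeff h k a) (hne : ¬ h =ᶠ[𝓝 0] id) :
    ∃ l φ, k ≤ l ∧ AnalyticAt ℂ φ 0 ∧ φ 0 ≠ 0 ∧ (∀ᶠ z in 𝓝 0, h z = z + z ^ (l + 1) * φ z) ∧
      (l = k → φ 0 = a) ∧ (k < l → a = 0) := by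
  have h1 : AnalyticAt ℂ (fun z => h z - z) 0 := hh.sub analyticAt_id
  obtain ⟨n, φ, hφ, hφ0, hev⟩ := h1.exists_eventuallyEq_pow_smul_nonzero_iff.2 fun h0 =>
    hne (h0.mono fun z hz => sub_eq_zero.1 hz)
  simp only [sub_zero, smul_eq_mul] at hev
  have hφt : Tendsto φ (𝓝[≠] 0) (𝓝 (φ 0)) := hφ.continuousAt.tendsto.mono_left nhdsWithin_le_nhds
  have hpow : ∀ m : ℕ, Tendsto (fun z : ℂ => z ^ m) (𝓝[≠] 0) (𝓝 (0 ^ m)) := fun m =>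
    ((continuous_pow m).tendsto 0).mono_left nhdsWithin_le_nhds
  -- A smaller vanishing order would make `φ 0` the limit of a convergent quotient times a positive
  -- power of z, hence 0.
  have hn : k + 1 ≤ n := by
    by_contra! hlt
    obtain ⟨m, hm⟩ := Nat.exists_eq_add_of_lt hlt
    have h2 : Tendsto (fun z => (h z - z) / z ^ (k + 1) * z ^ (m + 1)) (𝓝[≠] 0)
        (𝓝 (a * 0 ^ (m + 1))) := Tendsto.mul hL (hpow (m + 1))
    have h3 : φ 0 = a * 0 ^ (m + 1) := by
      refine tendsto_nhds_unique hφt (h2.congr' ?_)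
      filter_upwards [self_mem_nhdsWithin, nhdsWithin_le_nhds hev] with z hz hzev
      have hz0 : z ≠ 0 := hz
      rw [hzev, hm, add_assoc, pow_add z n]
      field_simp
    exact hφ0 (by simpa using h3)
  obtain ⟨m, rfl⟩ := Nat.exists_eq_add_of_le hn
  have ha : a = 0 ^ m * φ 0 := by
    refine tendsto_nhds_unique hL (((hpow m).mul hφt).congr' ?_)
    filter_upwards [self_mem_nhdsWithin, nhdsWithin_le_nhds hev] with z hz hzev
    have hz0 : z ≠ 0 := hz
    rw [hzev, pow_add]
    field_simp
  refine ⟨k + m, φ, by omega, hφ, hφ0, ?_, ?_, ?_⟩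
  · filter_upwards [hev] with z hz
    rw [show k + m + 1 = k + 1 + m by ring, ← hz]
    ring
  · intro hm
    have : m = 0 := by omega
    simp [ha, this]
  · intro hm
    have : m ≠ 0 := by omega
    simp [ha, this]

/-- Two germs leaving `J` invariant and inverse to each other. -/
structure GermPair (J : Set ℂ) (f fs : ℂ → ℂ) : Prop where
  inv : InvGerm J f
  inv' : InvGerm J fs
  left : fs ∘ f =ᶠ[𝓝 0] id
  right : f ∘ fs =ᶠ[𝓝 0] id

theorem GermPair.symm {J : Set ℂ} {f fs : ℂ → ℂ} (h : GermPair J f fs) : GermPair J fs f :=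
  ⟨h.inv', h.inv, h.right, h.left⟩

theorem GermPair.left_iterate {J : Set ℂ} {f fs : ℂ → ℂ} (h : GermPair J f fs) (n : ℕ) :
    fs^[n] ∘ f^[n] =ᶠ[𝓝 0] _root_.id := by
  induction n with
  | zero => exact EventuallyEq.rfl
  | succ n ih =>
    rw [Function.iterate_succ fs, Function.iterate_succ' f]
    filter_upwards [ih, (h.inv.iterate n).tendsto.eventually h.left] with z hz1 hz2
    simp only [Function.comp, _root_.id] at hz1 hz2 ⊢
    rw [hz2, hz1]

theorem GermPair.iterate {J : Set ℂ} {f fs : ℂ → ℂ} (h : GermPair J f fs) (n : ℕ) :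
    GermPair J f^[n] fs^[n] :=
  ⟨h.inv.iterate n, h.inv'.iterate n, h.left_iterate n, h.symm.left_iterate n⟩

theorem GermPair.deriv_inv {J : Set ℂ} {f fs : ℂ → ℂ} (h : GermPair J f fs) :
    deriv fs 0 = (deriv f 0)⁻¹ := by
  have h1 := h.left.deriv_eq
  rw [deriv_comp 0 (by rw [h.inv.map_zero]; exact h.inv'.analyticAt.differentiableAt)
    h.inv.analyticAt.differentiableAt, h.inv.map_zero, deriv_id] at h1
  exact eq_inv_of_mul_eq_one_left h1

theorem GermPair.leadingCoeff_inv {J : Set ℂ} {f fs : ℂ → ℂ} (h : GermPair J f fs) {k : ℕ}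
    (hk : k ≠ 0) {a : ℂ} (hL : LeadingCoeff f k a) : LeadingCoeff fs k (-a) := by
  have ht := h.inv'.tendsto_punctured
  have h1 := ((Tendsto.comp hL ht).neg).mul ((((hL.tendsto_div hk).comp ht).inv₀ one_ne_zero).pow (k + 1))
  rw [inv_one, one_pow, mul_one] at h1
  refine h1.congr' ?_
  filter_upwards [self_mem_nhdsWithin, h.inv'.eventually_ne_zero, nhdsWithin_le_nhds h.right]
    with y hy hy1 hy2
  have hy0 : y ≠ 0 := hy
  simp only [Function.comp, _root_.id] at hy2 ⊢
  rw [hy2, inv_div, div_pow]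
  have hy3 := pow_ne_zero (k + 1) hy0
  have hy4 := pow_ne_zero (k + 1) hy1
  generalize y ^ (k + 1) = Y at *
  generalize fs y ^ (k + 1) = Z at *
  field_simp
  ring

/-- Integer iterates of `f`, with inverse `fs`. -/
def germPow (f fs : ℂ → ℂ) : ℤ → ℂ → ℂ
  | Int.ofNat n => f^[n]
  | Int.negSucc n => fs^[n + 1]

theorem germPow_natCast (f fs : ℂ → ℂ) (n : ℕ) : germPow f fs n = f^[n] := rfl

theorem germPow_neg_natCast (f fs : ℂ → ℂ) (n : ℕ) : germPow f fs (-n) = fs^[n] := by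
  cases n with
  | zero => rfl
  | succ n => rfl

theorem germPow_mul (f fs : ℂ → ℂ) (q : ℕ) (m : ℤ) :
    germPow f fs (q * m) = germPow f^[q] fs^[q] m := by
  obtain ⟨n, rfl | rfl⟩ := m.eq_nat_or_neg
  · rw [← Nat.cast_mul, germPow_natCast, germPow_natCast, Function.iterate_mul]
  · rw [mul_neg, ← Nat.cast_mul, germPow_neg_natCast, germPow_neg_natCast, Function.iterate_mul]

theorem GermPair.invGerm_germPow {J : Set ℂ} {f fs : ℂ → ℂ} (h : GermPair J f fs) (m : ℤ) :
    InvGerm J (germPow f fs m) := by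
  obtain ⟨n, rfl | rfl⟩ := m.eq_nat_or_neg
  · exact h.inv.iterate n
  · rw [germPow_neg_natCast]; exact h.inv'.iterate n

theorem GermPair.germPow_neg_comp {J : Set ℂ} {f fs : ℂ → ℂ} (h : GermPair J f fs) (m : ℤ) :
    germPow f fs (-m) ∘ germPow f fs m =ᶠ[𝓝 0] _root_.id := by
  obtain ⟨n, rfl | rfl⟩ := m.eq_nat_or_neg
  · rw [germPow_neg_natCast, germPow_natCast]; exact h.left_iterate n
  · rw [neg_neg, germPow_neg_natCast, germPow_natCast]; exact h.symm.left_iterate n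

theorem GermPair.deriv_germPow {J : Set ℂ} {f fs : ℂ → ℂ} (h : GermPair J f fs) (m : ℤ) :
    deriv (germPow f fs m) 0 = deriv f 0 ^ m := by
  obtain ⟨n, rfl | rfl⟩ := m.eq_nat_or_neg
  · rw [germPow_natCast, h.inv.deriv_iterate, zpow_natCast]
  · rw [germPow_neg_natCast, h.inv'.deriv_iterate, h.deriv_inv, zpow_neg, zpow_natCast, inv_pow]

theorem GermPair.leadingCoeff_germPow {J : Set ℂ} {f fs : ℂ → ℂ} (h : GermPair J f fs) {k : ℕ}
    (hk : k ≠ 0) {a : ℂ} (hL : LeadingCoeff f k a) (m : ℤ) :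
    LeadingCoeff (germPow f fs m) k (m * a) := by
  obtain ⟨n, rfl | rfl⟩ := m.eq_nat_or_neg
  · exact hL.iterate hk h.inv n
  · rw [germPow_neg_natCast]
    convert! (h.leadingCoeff_inv hk hL).iterate hk h.inv' n using 1
    push_cast; ring

/-! ### Lamination or relation. -/

/-- `J` is analytically laminated in a punctured neighbourhood of `0` as soon as it is invariant
under germs of order `l ≥ k`, nonconstant and small compared with the order `k`. -/
def LaminatedByHigherOrder (J : Set ℂ) (k : ℕ) : Prop :=
  ∀ (l : ℕ) (h : ℕ → ℂ → ℂ) (b : ℕ → ℂ) (B : ℝ), (∀ j, InvGerm J (h j)) →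
    (∀ j, LeadingCoeff (h j) l (b j)) → (∀ j, b j ≠ 0) → (∀ j, ‖b j‖ ≤ B) → k ≤ l →
    (k < l ∨ Tendsto b atTop (𝓝 0)) →
    ∀ᶠ z in 𝓝[≠] (0 : ℂ), AnalyticallyLaminatedAt J z

/-- A germ with a nonzero leading coefficient provides a radius for its summable orbits. -/
theorem exists_radius_laminated_of_leadingCoeff {J : Set ℂ} (hJ : IsClosed J) {f : ℂ → ℂ} {k : ℕ}
    {a : ℂ} (hf : InvGerm J f) (hL : LeadingCoeff f k a) (ha : a ≠ 0) :
    ∃ r > 0, ∀ z : ℂ, z ≠ 0 → (∀ n, ‖f^[n] z‖ < r) → (Summable fun n => ‖f^[n] z‖ ^ (k + 1)) →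
      ∀ (l : ℕ) (h : ℕ → ℂ → ℂ) (b : ℕ → ℂ) (B : ℝ), (∀ j, InvGerm J (h j)) →
      (∀ j, LeadingCoeff (h j) l (b j)) → (∀ j, b j ≠ 0) → (∀ j, ‖b j‖ ≤ B) → k ≤ l →
      (k < l ∨ Tendsto b atTop (𝓝 0)) → AnalyticallyLaminatedAt J z := by
  have hne : ¬ f =ᶠ[𝓝 0] id := fun h =>
    ha (tendsto_nhds_unique (hL.congr h) (leadingCoeff_id k))
  obtain ⟨l, φ, hkl, hφ, hφ0, hev, h1, h2⟩ := hL.exists_factor hf.analyticAt hne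
  obtain rfl : l = k := by
    by_contra hlk
    exact ha (h2 (by omega))
  have h0 : 1 + 0 ^ l * φ 0 ≠ 0 := by
    rcases Nat.eq_zero_or_pos l with rfl | hl
    · have h3 := LeadingCoeff.of_hasDerivAt hf.map_zero hf.analyticAt.differentiableAt.hasDerivAt
      have h4 := tendsto_nhds_unique hL h3
      rw [h1 rfl, h4]
      simpa using hf.deriv_ne_zero
    · simp [zero_pow hl.ne']
  obtain ⟨r, hr, hrB⟩ := exists_radius_laminated_of_orbit hJ hf hφ hev h0
  exact ⟨r, hr, fun z hz hzr hzs => hrB (fun n => f^[n] z)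
    (fun n => Function.iterate_succ_apply' f n z) hz hzr hzs⟩

theorem laminatedByHigherOrder_of_contracting {J : Set ℂ} (hJ : IsClosed J) {f : ℂ → ℂ}
    (hf : InvGerm J f) (hd : ‖deriv f 0‖ < 1) : LaminatedByHigherOrder J 0 := by
  intro l h b B hh hL hb hbB hkl hsmall
  have ha : deriv f 0 - 1 ≠ 0 := by
    intro h0
    rw [sub_eq_zero.1 h0] at hd
    simp at hd
  obtain ⟨r, hr, hrB⟩ := exists_radius_laminated_of_leadingCoeff hJ hf
    (LeadingCoeff.of_hasDerivAt hf.map_zero hf.analyticAt.differentiableAt.hasDerivAt) ha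
  obtain ⟨ρ, hρ, hρB⟩ := exists_radius_orbit_summable_of_contracting
    hf.analyticAt.differentiableAt hf.map_zero hd hr
  filter_upwards [self_mem_nhdsWithin, nhdsWithin_le_nhds (Metric.ball_mem_nhds 0 hρ)] with z hz hzρ
  obtain ⟨h1, h2⟩ := hρB z (by simpa using hzρ)
  exact hrB z hz h1 h2 l h b B hh hL hb hbB hkl hsmall

/-- In the coordinate -1/(k a z^k), points of the right half-plane have summable orbits under `f`.
The coordinate of `fs` is the opposite one, so the remaining points have summable orbits under `fs`.
-/
theorem laminatedByHigherOrder_of_parabolic {J : Set ℂ} (hJ : IsClosed J) {f fs : ℂ → ℂ}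
    (hf : GermPair J f fs) {k : ℕ} (hk : k ≠ 0) {a : ℂ} (ha : a ≠ 0) (hfL : LeadingCoeff f k a) :
    LaminatedByHigherOrder J k := by
  intro l h b B hh hL hb hbB hkl hsmall
  have hfsL := hf.leadingCoeff_inv hk hfL
  obtain ⟨r₁, hr₁, hr₁B⟩ := exists_radius_laminated_of_leadingCoeff hJ hf.inv hfL ha
  obtain ⟨r₂, hr₂, hr₂B⟩ := exists_radius_laminated_of_leadingCoeff hJ hf.inv' hfsL
    (neg_ne_zero.2 ha)
  obtain ⟨ρ₁, hρ₁, hρ₁B⟩ := exists_radius_orbit_summable_of_parabolic hk ha hfL hr₁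
  obtain ⟨ρ₂, hρ₂, hρ₂B⟩ := exists_radius_orbit_summable_of_parabolic hk (neg_ne_zero.2 ha) hfsL hr₂
  filter_upwards [self_mem_nhdsWithin, nhdsWithin_le_nhds (Metric.ball_mem_nhds 0 hρ₁),
    nhdsWithin_le_nhds (Metric.ball_mem_nhds 0 hρ₂)] with z hz hz₁ hz₂
  rcases le_total 0 (-((k : ℂ) * a * z ^ k)⁻¹).re with h0 | h0
  · obtain ⟨h1, h2⟩ := hρ₁B z hz (by simpa using hz₁) h0
    exact hr₁B z hz h1 h2 l h b B hh hL hb hbB hkl hsmall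
  · obtain ⟨h1, h2⟩ := hρ₂B z hz (by simpa using hz₂) (by
      rw [mul_neg, neg_mul, inv_neg, neg_neg]
      rw [Complex.neg_re] at h0
      linarith)
    exact hr₂B z hz h1 h2 l h b B hh hL hb hbB hkl hsmall

/-- Two germs with real logarithms `α`, `β` relative to the order `k` either satisfy a relation or
force lamination, according to whether `β / α` is rational. -/
theorem laminated_or_relation {J : Set ℂ} {k : ℕ} (hJk : LaminatedByHigherOrder J k)
    {f fs g gs : ℂ → ℂ} (hf : GermPair J f fs) (hg : GermPair J g gs) {α β : ℝ} (hα : α ≠ 0)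
    {coef : ℝ → ℂ} (hcoef : ContinuousAt coef 0) (hcoef0 : ∀ t, coef t = 0 ↔ t = 0)
    (hL : ∀ m n : ℤ, LeadingCoeff (germPow g gs n ∘ germPow f fs m) k (coef (m * α + n * β))) :
    (∀ᶠ z in 𝓝[≠] (0 : ℂ), AnalyticallyLaminatedAt J z) ∨
      ∃ m n : ℤ, (m, n) ≠ (0, 0) ∧ germPow f fs m =ᶠ[𝓝 0] germPow g gs n := by
  have hinv : ∀ m n : ℤ, InvGerm J (germPow g gs n ∘ germPow f fs m) := fun m n =>
    (hg.invGerm_germPow n).comp (hf.invGerm_germPow m)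
  have hc0 : coef 0 = 0 := (hcoef0 0).2 rfl
  by_cases hirr : Irrational (β / α)
  · left
    have hdense := dense_addSubgroupClosure_pair_iff.2 hirr
    have hex : ∀ j : ℕ, ∃ m n : ℤ, 0 < m * α + n * β ∧ m * α + n * β < 1 / ((j : ℝ) + 1) := by
      intro j
      obtain ⟨x, hx, hx1, hx2⟩ := hdense.exists_between (Nat.one_div_pos_of_nat (n := j) (α := ℝ))
      obtain ⟨n, m, rfl⟩ := AddSubgroup.mem_closure_pair.1 hx
      refine ⟨m, n, ?_, ?_⟩ <;> simp only [zsmul_eq_mul] at hx1 hx2 <;> linarith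
    choose m n h0 h1 using hex
    have hlim : Tendsto (fun j => coef (m j * α + n j * β)) atTop (𝓝 0) := by
      have h2 : Tendsto (fun j => m j * α + n j * β) atTop (𝓝 0) :=
        squeeze_zero (fun j => (h0 j).le) (fun j => (h1 j).le)
          tendsto_one_div_add_atTop_nhds_zero_nat
      have h3 := hcoef.tendsto.comp h2
      rwa [hc0] at h3
    obtain ⟨B, hB⟩ := hlim.norm.bddAbove_range
    exact hJk k (fun j => germPow g gs (n j) ∘ germPow f fs (m j)) _ B (fun j => hinv _ _)
      (fun j => hL _ _) (fun j => fun h => (h0 j).ne' ((hcoef0 _).1 h))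
      (fun j => hB ⟨j, rfl⟩) le_rfl (Or.inr hlim)
  -- In the rational case the word with exponents `-q.num` and `q.den` has vanishing coefficient at
  -- order `k`. It is either the identity or a germ of strictly higher order.
  · obtain ⟨q, hq⟩ : ∃ q : ℚ, (q : ℝ) = β / α := by
      by_contra hcon
      exact hirr hcon
    have hrel : ((-q.num : ℤ) : ℝ) * α + (q.den : ℤ) * β = 0 := by
      have h1 : β = q * α := by rw [hq]; field_simp
      have h2 : (q.den : ℝ) * q = q.num := by exact_mod_cast Rat.den_mul_eq_num q
      rw [h1]
      push_cast
      linear_combination α * h2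
    have hh := hinv (-q.num) q.den
    have hLh := hL (-q.num) q.den
    rw [hrel, hc0] at hLh
    by_cases hid : germPow g gs q.den ∘ germPow f fs (-q.num) =ᶠ[𝓝 0] id
    · right
      refine ⟨q.num, q.den, fun h => q.den_ne_zero (by simpa using (Prod.ext_iff.1 h).2), ?_⟩
      have h1 := hf.germPow_neg_comp q.num
      have h2 := (hf.invGerm_germPow q.num).tendsto.eventually hid
      filter_upwards [h1, h2] with z hz1 hz2
      simp only [Function.comp, _root_.id] at hz1 hz2
      rw [← hz2, hz1]
    · left
      obtain ⟨l, φ, hkl, hφ, hφ0, hev, h1, -⟩ := hLh.exists_factor hh.analyticAt hid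
      have hlt : k < l := lt_of_le_of_ne hkl fun h => hφ0 (h1 h.symm)
      exact hJk l (fun _ => germPow g gs q.den ∘ germPow f fs (-q.num)) (fun _ => φ 0) ‖φ 0‖
        (fun _ => hh) (fun _ => LeadingCoeff.of_factor hφ.continuousAt hev) (fun _ => hφ0)
        (fun _ => le_rfl) hkl (Or.inl hlt)

/-- At order 0 the leading coefficient is the multiplier minus 1, so a word with logarithm t has
coefficient exp t - 1. The contracting germ is `f` or its inverse. -/
theorem laminated_or_relation_of_hyperbolic {J : Set ℂ} (hJ : IsClosed J)
    {f fs g gs : ℂ → ℂ} (hf : GermPair J f fs) (hg : GermPair J g gs) {x y : ℝ} (hx : 0 < x)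
    (hy : 0 < y) (hfx : deriv f 0 = x) (hgy : deriv g 0 = y) (hx1 : x ≠ 1) :
    (∀ᶠ z in 𝓝[≠] (0 : ℂ), AnalyticallyLaminatedAt J z) ∨
      ∃ m n : ℤ, (m, n) ≠ (0, 0) ∧ germPow f fs m =ᶠ[𝓝 0] germPow g gs n := by
  have hJk : LaminatedByHigherOrder J 0 := by
    rcases lt_or_gt_of_ne hx1 with h | h
    · refine laminatedByHigherOrder_of_contracting hJ hf.inv ?_
      rw [hfx, Complex.norm_real, Real.norm_of_nonneg hx.le]
      exact h
    · refine laminatedByHigherOrder_of_contracting hJ hf.inv' ?_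
      rw [hf.deriv_inv, hfx, norm_inv, Complex.norm_real, Real.norm_of_nonneg hx.le]
      exact inv_lt_one_of_one_lt₀ h
  refine laminated_or_relation hJk hf hg (α := Real.log x) (β := Real.log y)
    (Real.log_ne_zero_of_pos_of_ne_one hx hx1) (coef := fun t => ((Real.exp t - 1 : ℝ) : ℂ))
    (by fun_prop) (fun t => ?_) fun m n => ?_
  · rw [Complex.ofReal_eq_zero, sub_eq_zero, Real.exp_eq_one_iff]
  · have hh := (hg.invGerm_germPow n).comp (hf.invGerm_germPow m)
    have h1 := LeadingCoeff.of_hasDerivAt hh.map_zero hh.analyticAt.differentiableAt.hasDerivAt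
    have hf0 := (hf.invGerm_germPow m).map_zero
    have h2 : deriv (germPow g gs n ∘ germPow f fs m) 0 = (y : ℂ) ^ n * (x : ℂ) ^ m := by
      rw [deriv_comp 0 (by rw [hf0]; exact (hg.invGerm_germPow n).analyticAt.differentiableAt)
        (hf.invGerm_germPow m).analyticAt.differentiableAt, hf0, hg.deriv_germPow,
        hf.deriv_germPow, hfx, hgy]
    have h3 : Real.exp (m * Real.log x + n * Real.log y) = y ^ n * x ^ m := by
      rw [Real.exp_add, mul_comm (m : ℝ), mul_comm (n : ℝ), ← Real.rpow_def_of_pos hx,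
        ← Real.rpow_def_of_pos hy, Real.rpow_intCast, Real.rpow_intCast, mul_comm]
    rw [h3]
    rw [h2] at h1
    push_cast
    exact h1

/-- Off `J`, any submersion serves with `K = ∅`. -/
theorem analyticallyLaminatedAt_of_eventually_notMem {J : Set ℂ}
    (h : ∀ᶠ z in 𝓝[≠] (0 : ℂ), z ∉ J) : ∀ᶠ z in 𝓝[≠] (0 : ℂ), AnalyticallyLaminatedAt J z := by
  filter_upwards [eventually_eventually_nhdsWithin.2 h, self_mem_nhdsWithin] with z hz hz0
  have hz0' : z ≠ 0 := hz0
  rw [IsOpen.nhdsWithin_eq isOpen_compl_singleton hz0] at hz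
  obtain ⟨ρ, hρ, hρB⟩ := Metric.eventually_nhds_iff_ball.1 hz
  refine ⟨Metric.ball z ρ, Metric.isOpen_ball, Metric.mem_ball_self hρ, Complex.re, ∅,
    fun w _ => Complex.reCLM.analyticAt w, fun w _ => ?_, ?_⟩
  · rw [show (Complex.re : ℂ → ℝ) = Complex.reCLM from rfl, ContinuousLinearMap.fderiv]
    exact Complex.re_surjective
  · ext w
    simp only [mem_inter_iff, preimage_empty, mem_empty_iff_false, and_false, iff_false]
    exact fun hw => hρB w hw.2 hw.1

/-- The tangent-to-the-identity case, for germs of ordered orders. -/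
theorem laminated_or_relation_of_parabolic {J : Set ℂ} (hJ : IsClosed J)
    {f fs g gs : ℂ → ℂ} (hf : GermPair J f fs) (hg : GermPair J g gs)
    {k l : ℕ} (hk : k ≠ 0) (hkl : k ≤ l) {a b : ℂ} (ha : a ≠ 0) (hb : b ≠ 0)
    (hfL : LeadingCoeff f k a) (hgL : LeadingCoeff g l b)
    {v : ℂ} (hv : ‖v‖ = 1) {δ : ℝ} (hδ : 0 < δ) {r : ℝ}
    (hr : 0 < r) (hsec : ∀ z ∈ J, z ≠ 0 → ‖z‖ < r → δ ≤ ‖z / ‖z‖ - v‖) :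
    (∀ᶠ z in 𝓝[≠] (0 : ℂ), AnalyticallyLaminatedAt J z) ∨
      ∃ m n : ℤ, (m, n) ≠ (0, 0) ∧ germPow f fs m =ᶠ[𝓝 0] germPow g gs n := by
  have hJk := laminatedByHigherOrder_of_parabolic hJ hf hk ha hfL
  rcases hkl.lt_or_eq with hlt | rfl
  · exact Or.inl (hJk l (fun _ => g) (fun _ => b) ‖b‖ (fun _ => hg.inv) (fun _ => hgL)
      (fun _ => hb) (fun _ => le_rfl) hkl (Or.inl hlt))
  -- This says that b / a is real. The coefficients of all words then lie on the real line through
  -- `a`, and their real coordinates play the role of logarithms.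
  by_cases him : ((starRingEnd ℂ) a * b).im = 0
  · have hna : (Complex.normSq a : ℂ) ≠ 0 := by simpa using ha
    set c : ℝ := ((starRingEnd ℂ) a * b).re / Complex.normSq a with hc
    have hbc : b = c * a := by
      have h1 : (starRingEnd ℂ) a * b = (((starRingEnd ℂ) a * b).re : ℂ) :=
        Complex.ext (by simp) (by simpa using him)
      rw [hc]
      push_cast
      rw [← h1, Complex.normSq_eq_conj_mul_self]
      have : (starRingEnd ℂ) a ≠ 0 := by simpa using ha
      field_simp
    refine laminated_or_relation hJk hf hg (α := 1) (β := c) one_ne_zero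
      (coef := fun t => (t : ℂ) * a) (by fun_prop) (fun t => by simp [ha]) fun m n => ?_
    have h1 := leadingCoeff_comp hk (hf.invGerm_germPow m) (hg.leadingCoeff_germPow hk hgL n)
      (hf.leadingCoeff_germPow hk hfL m)
    convert! h1 using 1
    rw [hbc]
    push_cast
    ring
  · left
    refine analyticallyLaminatedAt_of_eventually_notMem
      (eventually_notMem_of_independent hJ hk him ?_ hv hδ hr hsec)
    rintro e (rfl | rfl | rfl | rfl)
    · exact ⟨f, hf.inv, hfL⟩
    · exact ⟨fs, hf.inv', hf.leadingCoeff_inv hk hfL⟩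
    · exact ⟨g, hg.inv, hgL⟩
    · exact ⟨gs, hg.inv', hg.leadingCoeff_inv hk hgL⟩

theorem exists_leadingCoeff_of_deriv_eq_one {J : Set ℂ} {f : ℂ → ℂ} (hf : InvGerm J f)
    (hd : deriv f 0 = 1) (hne : ¬ f =ᶠ[𝓝 0] id) :
    ∃ k a, k ≠ 0 ∧ a ≠ 0 ∧ LeadingCoeff f k a := by
  have h1 := LeadingCoeff.of_hasDerivAt hf.map_zero hf.analyticAt.differentiableAt.hasDerivAt
  rw [hd, sub_self] at h1
  obtain ⟨l, φ, -, hφ, hφ0, hev, h2, -⟩ := h1.exists_factor hf.analyticAt hne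
  exact ⟨l, φ 0, fun h => hφ0 (h2 h), hφ0, LeadingCoeff.of_factor hφ.continuousAt hev⟩

theorem laminated_or_relation_of_positive {J : Set ℂ} (hJ : IsClosed J)
    {f fs g gs : ℂ → ℂ} (hf : GermPair J f fs) (hg : GermPair J g gs) {x y : ℝ} (hx : 0 < x)
    (hy : 0 < y) (hfx : deriv f 0 = x) (hgy : deriv g 0 = y)
    {v : ℂ} (hv : ‖v‖ = 1) {δ : ℝ} (hδ : 0 < δ) {r : ℝ}
    (hr : 0 < r) (hsec : ∀ z ∈ J, z ≠ 0 → ‖z‖ < r → δ ≤ ‖z / ‖z‖ - v‖) :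
    (∀ᶠ z in 𝓝[≠] (0 : ℂ), AnalyticallyLaminatedAt J z) ∨
      ∃ m n : ℤ, (m, n) ≠ (0, 0) ∧ germPow f fs m =ᶠ[𝓝 0] germPow g gs n := by
  have hswap : ((∀ᶠ z in 𝓝[≠] (0 : ℂ), AnalyticallyLaminatedAt J z) ∨
      ∃ m n : ℤ, (m, n) ≠ (0, 0) ∧ germPow g gs m =ᶠ[𝓝 0] germPow f fs n) →
      ((∀ᶠ z in 𝓝[≠] (0 : ℂ), AnalyticallyLaminatedAt J z) ∨
      ∃ m n : ℤ, (m, n) ≠ (0, 0) ∧ germPow f fs m =ᶠ[𝓝 0] germPow g gs n) := by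
    rintro (h | ⟨m, n, hmn, h⟩)
    · exact Or.inl h
    · exact Or.inr ⟨n, m, fun h0 => hmn (by simp_all), h.symm⟩
  by_cases hx1 : x = 1
  · by_cases hy1 : y = 1
    · subst hx1 hy1
      by_cases hfid : f =ᶠ[𝓝 0] id
      · exact Or.inr ⟨1, 0, by simp, hfid⟩
      by_cases hgid : g =ᶠ[𝓝 0] id
      · exact Or.inr ⟨0, 1, by simp, hgid.symm⟩
      obtain ⟨k, a, hk, ha, hfL⟩ := exists_leadingCoeff_of_deriv_eq_one hf.inv (by simpa using hfx)
        hfid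
      obtain ⟨l, b, hl, hb, hgL⟩ := exists_leadingCoeff_of_deriv_eq_one hg.inv (by simpa using hgy)
        hgid
      rcases le_total k l with h | h
      · exact laminated_or_relation_of_parabolic hJ hf hg hk h ha hb hfL hgL hv hδ hr hsec
      · exact hswap (laminated_or_relation_of_parabolic hJ hg hf hl h hb ha hgL hfL hv hδ hr hsec)
    · exact hswap (laminated_or_relation_of_hyperbolic hJ hg hf hy hx hgy hfx hy1)
  · exact laminated_or_relation_of_hyperbolic hJ hf hg hx hy hfx hgy hx1

/-- The dichotomy for germs leaving a closed set invariant. -/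
theorem laminated_or_relation_of_germPair {J : Set ℂ} (hJ : IsClosed J)
    {f fs g gs : ℂ → ℂ} (hf : GermPair J f fs) (hg : GermPair J g gs)
    (hcone : posTangentConeAt J 0 ≠ univ) :
    (∀ᶠ z in 𝓝[≠] (0 : ℂ), AnalyticallyLaminatedAt J z) ∨
      ∃ m n : ℤ, (m, n) ≠ (0, 0) ∧ germPow f fs m =ᶠ[𝓝 0] germPow g gs n := by
  by_cases hacc : ∃ᶠ z in 𝓝[≠] (0 : ℂ), z ∈ J
  · obtain ⟨v, hv, δ, hδ, r, hr, hsec⟩ := exists_sector_of_posTangentConeAt_ne_univ hacc hcone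
    obtain ⟨p, hp, hfp⟩ := exists_pow_multiplier_eq_norm hf.inv hacc hv hδ hr hsec
    obtain ⟨q, hq, hgq⟩ := exists_pow_multiplier_eq_norm hg.inv hacc hv hδ hr hsec
    rcases laminated_or_relation_of_positive hJ (hf.iterate p) (hg.iterate q)
      (pow_pos (norm_pos_iff.2 hf.inv.deriv_ne_zero) p)
      (pow_pos (norm_pos_iff.2 hg.inv.deriv_ne_zero) q)
      ((hf.inv.deriv_iterate p).trans hfp) ((hg.inv.deriv_iterate q).trans hgq) hv hδ hr hsec
      with h | ⟨m, n, hmn, h⟩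
    · exact Or.inl h
    · refine Or.inr ⟨p * m, q * n, fun h0 => hmn ?_, ?_⟩
      · simpa [hp, hq] using h0
      · rw [germPow_mul, germPow_mul]; exact h
  · exact Or.inl (analyticallyLaminatedAt_of_eventually_notMem (not_frequently.1 hacc))

/-! ### From germs back to the maps on `U`. -/

theorem AnalyticallyLaminatedAt.congr {J J' : Set ℂ} {z : ℂ} (h : AnalyticallyLaminatedAt J z)
    (hJ : ∀ᶠ w in 𝓝 z, w ∈ J ↔ w ∈ J') : AnalyticallyLaminatedAt J' z := by
  obtain ⟨V, hV, hzV, σ, K, hσ, hσ', hJV⟩ := h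
  obtain ⟨W, hWJ, hW, hzW⟩ := eventually_nhds_iff.1 hJ
  refine ⟨V ∩ W, hV.inter hW, ⟨hzV, hzW⟩, σ, K, hσ.mono inter_subset_left,
    fun w hw => hσ' w hw.1, ?_⟩
  ext w
  have h1 : w ∈ J ∩ V ↔ w ∈ V ∩ σ ⁻¹' K := by rw [hJV]
  simp only [mem_inter_iff, mem_preimage] at h1 ⊢
  constructor
  · rintro ⟨hwJ, hwV, hwW⟩
    exact ⟨⟨hwV, hwW⟩, (h1.1 ⟨(hWJ w hwW).2 hwJ, hwV⟩).2⟩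
  · rintro ⟨⟨hwV, hwW⟩, hwK⟩
    exact ⟨(hWJ w hwW).1 (h1.2 ⟨hwV, hwK⟩).1, hwV, hwW⟩

theorem localIterate_eq_germPow (f : OpenPartialHomeomorph ℂ ℂ) (m : ℤ) :
    localIterate f m = germPow f f.symm m := by
  cases m <;> rfl

/-- An invertible holomorphic map has a holomorphic inverse. -/
theorem analyticAt_symm_of_differentiableOn (f : OpenPartialHomeomorph ℂ ℂ) {z : ℂ}
    (hz : z ∈ f.source) (hf : DifferentiableOn ℂ f f.source) : AnalyticAt ℂ f.symm (f z) := by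
  have hfa : AnalyticAt ℂ f z := hf.analyticAt (f.open_source.mem_nhds hz)
  have htgt := f.map_source hz
  have hsc : ContinuousAt f.symm (f z) := f.symm.continuousAt htgt
  have hst : Tendsto f.symm (𝓝[≠] (f z)) (𝓝[≠] z) := by
    refine tendsto_nhdsWithin_iff.2 ⟨?_, ?_⟩
    · have := hsc.tendsto.mono_left (nhdsWithin_le_nhds (s := {f z}ᶜ))
      rwa [f.left_inv hz] at this
    · filter_upwards [self_mem_nhdsWithin, nhdsWithin_le_nhds (f.open_target.mem_nhds htgt)]
        with w hw hwt h0
      refine hw ?_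
      have h1 : f.symm w = z := h0
      rw [mem_singleton_iff, ← h1, f.right_inv hwt]
  have hd : ∀ᶠ w in 𝓝[≠] z, deriv f w ≠ 0 := by
    rcases hfa.deriv.eventually_eq_zero_or_eventually_ne_zero with h0 | h0
    · exfalso
      have hev : ∀ᶠ w in 𝓝 z, deriv f w = 0 ∧ w ∈ f.source := h0.and (f.open_source.mem_nhds hz)
      obtain ⟨ρ, hρ, hρB⟩ := Metric.eventually_nhds_iff_ball.1 hev
      obtain ⟨w, hw⟩ : ∃ w ∈ Metric.ball z ρ, w ≠ z := by
        have h2 : ∀ᶠ w in 𝓝[≠] z, w ∈ Metric.ball z ρ ∧ w ≠ z := by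
          filter_upwards [nhdsWithin_le_nhds (Metric.ball_mem_nhds z hρ), self_mem_nhdsWithin]
            with w h3 h4 using ⟨h3, h4⟩
        obtain ⟨w, h3, h4⟩ := h2.exists
        exact ⟨w, h3, h4⟩
      refine hw.2 (f.injOn (hρB w hw.1).2 hz ?_)
      refine (convex_ball z ρ).is_const_of_fderivWithin_eq_zero (𝕜 := ℂ)
        (hf.mono fun y hy => (hρB y hy).2) (fun y hy => ?_) hw.1 (Metric.mem_ball_self hρ)
      rw [fderivWithin_of_isOpen Metric.isOpen_ball hy]
      ext
      simpa using (hρB y hy).1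
    · exact h0
  -- A zero of f' at z is at worst isolated by injectivity, so the inverse is differentiable on a
  -- punctured neighbourhood of f z. Its continuity there removes the singularity.
  refine Complex.analyticAt_of_differentiable_on_punctured_nhds_of_continuousAt ?_ hsc
  filter_upwards [hst.eventually hd, nhdsWithin_le_nhds (f.open_target.mem_nhds htgt)]
    with w hw hwt
  exact (f.hasDerivAt_symm hwt hw (hf.differentiableAt
    (f.open_source.mem_nhds (f.map_target hwt))).hasDerivAt).differentiableAt

theorem germPair_of_openPartialHomeomorph {J : Set ℂ} (f : OpenPartialHomeomorph ℂ ℂ)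
    (h0 : (0 : ℂ) ∈ f.source) (hf : DifferentiableOn ℂ f f.source) (hf0 : f 0 = 0)
    (hJ : ∀ᶠ z in 𝓝 0, f z ∈ J ↔ z ∈ J) : GermPair J f f.symm := by
  have hfa : AnalyticAt ℂ f 0 := hf.analyticAt (f.open_source.mem_nhds h0)
  have hsa : AnalyticAt ℂ f.symm 0 := by
    have := analyticAt_symm_of_differentiableOn f h0 hf
    rwa [hf0] at this
  have hs0 : f.symm 0 = 0 := by
    have := f.left_inv h0
    rwa [hf0] at this
  have ht0 : (0 : ℂ) ∈ f.target := by
    have := f.map_source h0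
    rwa [hf0] at this
  have hleft : f.symm ∘ f =ᶠ[𝓝 0] id := f.eventually_left_inverse h0
  have hright : f ∘ f.symm =ᶠ[𝓝 0] id := f.eventually_right_inverse ht0
  have hprod : deriv f.symm 0 * deriv f 0 = 1 := by
    have h1 := hleft.deriv_eq
    rwa [deriv_comp 0 (by rw [hf0]; exact hsa.differentiableAt) hfa.differentiableAt, hf0,
      deriv_id] at h1
  refine ⟨⟨hfa, hf0, right_ne_zero_of_mul_eq_one hprod, hJ⟩,
    ⟨hsa, hs0, left_ne_zero_of_mul_eq_one hprod, ?_⟩, hleft, hright⟩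
  have hst : Tendsto f.symm (𝓝 0) (𝓝 0) := by
    simpa [ContinuousAt, hs0] using hsa.continuousAt
  filter_upwards [hst.eventually hJ, hright] with z hz1 hz2
  simp only [Function.comp, id] at hz2
  rw [← hz1, hz2]

theorem mainTheorem2 (U : Set ℂ) (f g : OpenPartialHomeomorph ℂ ℂ) (J : Set ℂ)
    (hU : (0 : ℂ) ∈ U)
    (hf_source : f.source = U) (hg_source : g.source = U)
    (hf_hol : DifferentiableOn ℂ f U) (hg_hol : DifferentiableOn ℂ g U)
    (hf_zero : f 0 = 0) (hg_zero : g 0 = 0)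
    (hJU : J ⊆ U) (hJ_closed : IsClosed ((↑) ⁻¹' J : Set U))
    (hJf : CompletelyInvariantNearZero f U J) (hJg : CompletelyInvariantNearZero g U J)
    (hcone : posTangentConeAt J 0 ≠ Set.univ) :
    (∃ V : Set ℂ, IsOpen V ∧ (0 : ℂ) ∈ V ∧ V ⊆ U ∧ AnalyticallyLaminatedIn J (V \ {0})) ∨
    (∃ m n : ℤ, (m, n) ≠ (0, 0) ∧ localIterate f m =ᶠ[𝓝 0] localIterate g n) := by
  have hUo : IsOpen U := hf_source ▸ f.open_source
  obtain ⟨R, hR, hRU⟩ := Metric.nhds_basis_closedBall.mem_iff.1 (hUo.mem_nhds hU)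
  -- `J` is closed only relative to `U`. Cutting it by a closed disc inside `U` gives a closed
  -- subset of ℂ with the same germ at 0.
  set J' := J ∩ Metric.closedBall 0 R with hJ'
  have hJ'c : IsClosed J' := by
    obtain ⟨C, hC, hCJ⟩ := isClosed_induced_iff.1 hJ_closed
    have : J' = C ∩ Metric.closedBall 0 R := by
      ext z
      simp only [hJ', mem_inter_iff, and_congr_left_iff]
      intro hz
      have h1 : (⟨z, hRU hz⟩ : U) ∈ ((↑) ⁻¹' C : Set U) ↔ (⟨z, hRU hz⟩ : U) ∈ ((↑) ⁻¹' J : Set U) := by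
        rw [hCJ]
      exact h1.symm
    rw [this]
    exact hC.inter Metric.isClosed_closedBall
  have hJJ' : ∀ z ∈ Metric.ball (0 : ℂ) R, z ∈ J' ↔ z ∈ J := fun z hz =>
    ⟨fun h => h.1, fun h => ⟨h, Metric.ball_subset_closedBall hz⟩⟩
  have hinv : ∀ h : OpenPartialHomeomorph ℂ ℂ, h.source = U → h 0 = 0 →
      CompletelyInvariantNearZero h U J → ∀ᶠ z in 𝓝 0, h z ∈ J' ↔ z ∈ J' := by
    rintro h hs h0 ⟨V, hV, hVU, -, hVJ⟩
    have hc : Tendsto h (𝓝 0) (𝓝 0) := by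
      have := h.continuousAt (x := 0) (by rw [hs]; exact hU)
      rwa [ContinuousAt, h0] at this
    filter_upwards [hV, Metric.ball_mem_nhds 0 hR, hc (Metric.ball_mem_nhds 0 hR)] with z hzV hzR hzR'
    rw [hJJ' z hzR, hJJ' _ hzR']
    have h1 : z ∈ (U ∩ h ⁻¹' J) ∩ V ↔ z ∈ J ∩ V := by rw [hVJ]
    simp only [mem_inter_iff, mem_preimage] at h1
    have h2 := hVU hzV
    tauto
  have hpf : GermPair J' f f.symm := germPair_of_openPartialHomeomorph f (hf_source ▸ hU)
    (hf_source ▸ hf_hol) hf_zero (hinv f hf_source hf_zero hJf)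
  have hpg : GermPair J' g g.symm := germPair_of_openPartialHomeomorph g (hg_source ▸ hU)
    (hg_source ▸ hg_hol) hg_zero (hinv g hg_source hg_zero hJg)
  have hcone' : posTangentConeAt J' 0 ≠ univ := fun h =>
    hcone (eq_univ_of_univ_subset (h ▸ posTangentConeAt_mono inter_subset_left))
  rcases laminated_or_relation_of_germPair hJ'c hpf hpg hcone' with h | ⟨m, n, hmn, h⟩
  · left
    rw [eventually_nhdsWithin_iff] at h
    obtain ⟨ρ, hρ, hρB⟩ := Metric.eventually_nhds_iff_ball.1 h
    refine ⟨Metric.ball 0 ρ ∩ Metric.ball 0 R, Metric.isOpen_ball.inter Metric.isOpen_ball,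
      ⟨Metric.mem_ball_self hρ, Metric.mem_ball_self hR⟩,
      fun z hz => hRU (Metric.ball_subset_closedBall hz.2), ?_⟩
    rintro z ⟨⟨hzρ, hzR⟩, hz0⟩
    refine (hρB z hzρ hz0).congr ?_
    filter_upwards [Metric.isOpen_ball.mem_nhds hzR] with w hw
    exact hJJ' w hw
  · right
    refine ⟨m, n, hmn, ?_⟩
    rw [localIterate_eq_germPow, localIterate_eq_germPow]
    exact h
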